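/- **Setting.** Let $F$ be a closed oriented surface of genus $n$, obtained from a sphere with $2n$ open disks removed, $S_0$, by attaching $n$ annuli. Fix the standard based loops with $$\pi_1(F)=\Big\langle A_i,D_i\ (1\le i\le n)\ \Big|\ \prod_{i=1}^n[A_i,D_i]=1\Big\rangle,\qquad \pi_1(S_0)=\Big\langle A_i,B_i\ \Big|\ \prod_{i=1}^nA_iB_i^{-1}=1\Big\rangle ,$$ where $[x,y]=xyx^{-1}y^{-1}$ and $\pi_1(S_0)\to\pi_1(F)$ is $A_i\mapsto A_i$, $B_i\mapsto D_iA_iD_i^{-1}$. Each generator $E$ is an embedded curve joined to the base point by an arc $\gamma_E$; the generators with index $i$ lie in the $i$-th of $n$ cyclically ordered sectors. Identify $SU(2)$ with the unit quaternions. A representation to $SU(2)$ is *irreducible* if its stabilizer under conjugation is $\{\pm1\}$. Let $\mathcal M(F)=\operatorname{Hom}(\pi_1(F),SU(2))/\mathrm{conj}$ and $T:\mathcal M(F)\to\mathbb R^n$, $T(\rho)=(\operatorname{Re}\rho(A_1),\dots,\operatorname{Re}\rho(A_n))$. **Special perturbation curves.** Let $\mathcal C$ be the set of the $K=3n+8n(n-1)=8n^2-5n$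 oriented embedded curves $C_{I}(i),C_{II}(i),C_{III}(i)$ ($1\le i\le n$) and $C_{IV}(ij),\dots,C_{XI}(ij)$ ($i\ne j$) on $F$ which meet the generators as follows. If $C$ crosses $E$ or $\gamma_E$, it does so once, and $\lambda_C(E)$ denotes the longitude of $C$ with respect to $E$: go from the base point along $\gamma_E$ (and then $E$) to the crossing point, around $C$, and back. Put $W=\prod_{\ell=i+1}^{j-1}A_\ell B_\ell^{-1}$ and $P=\prod_{\ell=i}^{j}A_\ell B_\ell^{-1}$, with indices read cyclically. The generators $E$ crossed by $C$, with $\lambda_C(E)$ and the sign $E\cdot C$, are: * $C_I(i)$: $A_i$, $A_iD_iA_i^{-1}$, $-$. * $C_{II}(i)$: $D_i$, $D_iA_iD_i^{-1}$, $+$. * $C_{III}(i)$: $D_i$, $D_iA_i$, $+$; $A_i$, $A_iD_i$, $-$. * $C_{IV}(ij)$: $D_i$, $D_j^{-1}A_i$, $+$; $A_j$, $D_j^{-1}A_i$, $+$. * $C_{V}(ij)$: $A_i$, $D_jD_i$, $-$; $A_j$, $D_iD_j$, $-$. * $C_{VI}(ij)$: $A_i$, $A_iA_jA_iD_iA_i^{-1}$,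 $-$; $D_i$, $A_jA_iD_i$, $+$; $D_j$, $A_iD_iA_j$, $+$. * $C_{VII}(ij)$: $D_i$, $D_j^{-1}A_iD_i$, $+$; $A_i$, $A_iD_j^{-1}A_iD_iA_i^{-1}$, $-$; $A_j$, $D_j^{-1}A_iD_i$, $+$. * $C_{VIII}(ij)$: $D_i$, $WD_j^{-1}P^{-1}A_i$, $+$; $A_j$, $D_j^{-1}P^{-1}A_iW$, $+$. * $C_{IX}(ij)$: $D_i$, $WD_j^{-1}P^{-1}A_iD_i$, $+$; $A_j$, $D_j^{-1}P^{-1}A_iD_iW$, $+$; $A_i$, $A_iWD_j^{-1}P^{-1}A_iD_iA_i^{-1}$, $-$. * $C_{X}(ij)$: $A_i$, $PD_jW^{-1}D_i$, $-$; $A_j$, $W^{-1}D_iPD_j$, $-$. * $C_{XI}(ij)$: $D_i$, $WA_jP^{-1}A_iD_i$, $+$; $A_i$, $A_iWA_jP^{-1}A_iD_iA_i^{-1}$, $-$; $D_j$, $P^{-1}A_iD_iWA_j$, $+$. The curves IV–VII also cross each of the arcs $\gamma_{A_\ell},\gamma_{D_\ell}$, $\ell\ne i,j$, once, with sign $+,-,+,+$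 respectively and longitude (for $\ell$ cyclically between $i$ and $j$; for the remaining $\ell$): IV: $D_j^{-1}A_i$; $A_iD_j^{-1}$. V: $D_iD_j$; $D_jD_i$. VI: $A_jA_iD_i$; $A_iD_iA_j$. VII: $D_j^{-1}A_iD_i$; $A_iD_iD_j^{-1}$. There are no other intersections with generators or their arcs. **Perturbation maps.** For $C\in\mathcal C$ and $t\in\mathbb R$ let $N_C$ be a tubular neighborhood of $C\times\{\frac12\}$ in $F\times[0,1]$, with meridian $\mu$ and longitude $\lambda$. Let $\mathcal M_{C,t}$ be the set of conjugacy classes of representations $\tilde\rho:\pi_1\big((F\times[0,1])\setminus N_C\big)\to SU(2)$ with $\tilde\rho(\mu)=e^{t\sin(\alpha)Q}$ whenever $\tilde\rho(\lambda)=e^{\alpha Q}$, with $Q$ a purely imaginary unit quaternion. Restriction to $F\times\{0\}$ is a bijection $\mathcal M_{C,t}\to\mathcal M(F)$; let $\Phi_{C,t}:\mathcal M(F)\to\mathcal M(F)$ be its inverse followed by restriction to $F\times\{1\}$. For an ordering $\mathbf C=(C_1,\dots,C_K)$ of $\mathcal C$ and $\mathbf t\in\mathbb R^K$ put $\Phi_{\mathbf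 C}(\rho,\mathbf t)=\Phi_{C_K,t_K}\circ\cdots\circ\Phi_{C_1,t_1}(\rho)$. **Proposition.** Let $\mathbf C$ be any ordering of $\mathcal C$ and let $\rho:\pi_1(F)\to SU(2)$ be a representation such that 1. $\rho$ is irreducible, 2. the restriction of $\rho$ to $\pi_1(S_0)$ is irreducible, 3. $\operatorname{Re}(\rho(A_i))=0$ for $i=1,\dots,n$. Then the composite $T\circ\Phi_{\mathbf C}(\rho,-):\mathbb R^K\to\mathbb R^n$ is differentiable at $0\in\mathbb R^K$ and its differential at $0$ is surjective. -/

import Mathlib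

/-! Character varieties of the closed oriented surface `F` of genus `n`, the special perturbation
curves on `F`, and the holonomy perturbation maps they induce. -/

namespace TangleSurface

set_option linter.unusedSimpArgs false
set_option linter.flexible false

/-! ### `SU(2)` as the group of unit quaternions -/

/-- `SU(2)`, identified with the group of unit quaternions. -/
abbrev SU2 : Type := unitary (Quaternion ℝ)

/-- The real part of a unit quaternion (half of the trace of the matrix in `SU(2)`). -/
def realPart (q : SU2) : ℝ := (q : Quaternion ℝ).re

theorem unitary_of_normSq {q : Quaternion ℝ} (h : Quaternion.normSq q = 1) :
    q ∈ unitary (Quaternion ℝ) := by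
  rw [Unitary.mem_iff, Quaternion.star_mul_self, Quaternion.self_mul_star, h]
  simp

/-- The conjugation equivariant map `F : SU(2) → SU(2)`, `F(e^{αQ}) = e^{f(α)Q}`, attached to the
perturbation function `f(α) = t sin α`. Since the imaginary part of `e^{αQ} = cos α + (sin α) Q`
is `(sin α) Q`, this is `q ↦ exp (t Im q)`; see `pertMap_spec`. -/
noncomputable def pertMap (t : ℝ) (q : SU2) : SU2 :=
  ⟨NormedSpace.exp (t • (q : Quaternion ℝ).im), unitary_of_normSq (by
    rw [Quaternion.normSq_exp]; simp)⟩

/-- `F(e^{αQ}) = e^{(t sin α)Q}` for every purely imaginary unit quaternion `Q`. -/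
theorem pertMap_spec (t α : ℝ) (Q : Quaternion ℝ) (hre : Q.re = 0) (hQ : ‖Q‖ = 1) (q : SU2)
    (hq : (q : Quaternion ℝ) = NormedSpace.exp (α • Q)) :
    (pertMap t q : Quaternion ℝ) = NormedSpace.exp ((t * Real.sin α) • Q) := by
  have h1 : (NormedSpace.exp (α • Q)).im = Real.sin α • Q := by
    rw [Quaternion.exp_of_re_eq_zero _ (by simp [hre]), norm_smul, hQ, mul_one,
      Real.norm_eq_abs, Real.cos_abs]
    have hQi : Q.im = Q := by ext <;> simp [hre]
    rcases eq_or_ne α 0 with h0 | h0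
    · have h1im : (1 : Quaternion ℝ).im = 0 := by simpa using Quaternion.im_coe (1 : ℝ)
      simp [h0, h1im]
    · have : (Real.sin |α| / |α|) • α • Q = Real.sin α • Q := by
        rw [smul_smul]
        congr 1
        rcases abs_cases α with ⟨h, _⟩ | ⟨h, _⟩
        · rw [h]; field_simp
        · rw [h, Real.sin_neg]; field_simp
      rw [this]
      simp [hQi]
  simp only [pertMap, hq, h1, smul_smul]

theorem pertMap_conj (t : ℝ) (g q : SU2) : pertMap t (g * q * g⁻¹) = g * pertMap t q * g⁻¹ := by
  apply Subtype.ext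
  have hg1 : (g : Quaternion ℝ) * star (g : Quaternion ℝ) = 1 := Unitary.mul_star_self_of_mem g.2
  have hg2 : star (g : Quaternion ℝ) * (g : Quaternion ℝ) = 1 := Unitary.star_mul_self_of_mem g.2
  have hc : ∀ x : SU2, ((g * x * g⁻¹ : SU2) : Quaternion ℝ) = g * x * star (g : Quaternion ℝ) :=
    fun x => rfl
  have him : (((g * q * g⁻¹ : SU2) : Quaternion ℝ)).im
      = (g : Quaternion ℝ) * (q : Quaternion ℝ).im * star (g : Quaternion ℝ) := by
    have e : (q : Quaternion ℝ) = ((q : Quaternion ℝ).re : Quaternion ℝ) + (q : Quaternion ℝ).im :=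
      (Quaternion.re_add_im _).symm
    rw [hc]
    conv_lhs => rw [e]
    rw [mul_add, add_mul, ← (Quaternion.coe_commute _ (g : Quaternion ℝ)).eq, mul_assoc, hg1]
    ext <;> simp
    ring
  rw [hc]
  simp only [pertMap]
  rw [him]
  let _ : NormedAlgebra ℚ (Quaternion ℝ) := NormedAlgebra.restrictScalars ℚ ℝ _
  have := NormedSpace.exp_units_conj (𝔸 := Quaternion ℝ)
    ⟨(g : Quaternion ℝ), star (g : Quaternion ℝ), hg1, hg2⟩ (t • (q : Quaternion ℝ).im)
  simp only [Units.val_mk, Units.inv_mk] at this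
  rw [← this]
  congr 1
  simp

theorem pertMap_commute (t : ℝ) (q : SU2) : Commute (pertMap t q) q := by
  have h := pertMap_conj t q q
  rw [mul_inv_cancel_right] at h
  have h2 : pertMap t q * q = q * pertMap t q := by
    conv_lhs => rw [h]
    simp
  exact h2

theorem realPart_conj (g q : SU2) : realPart (g * q * g⁻¹) = realPart q := by
  have hg2 : star (g : Quaternion ℝ) * (g : Quaternion ℝ) = 1 := Unitary.star_mul_self_of_mem g.2
  have hc : ((g * q * g⁻¹ : SU2) : Quaternion ℝ) = g * q * star (g : Quaternion ℝ) := rfl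
  have hcomm : ∀ x y : Quaternion ℝ, (x * y).re = (y * x).re := by
    intro x y; simp; ring
  rw [realPart, hc, hcomm, ← mul_assoc, hg2, one_mul, realPart]

/-! ### Representations and character varieties -/

/-- `ρ` is irreducible: its stabilizer under conjugation is the center `{1, -1} ≅ ℤ/2`. -/
def IsIrreducible {G : Type} [Group G] (ρ : G →* SU2) : Prop :=
  ∀ g : SU2, (∀ x : G, g * ρ x * g⁻¹ = ρ x) ↔ g = 1 ∨ g = -1

/-- Conjugacy of `SU(2)` representations. -/
def conjSetoid (G : Type) [Group G] : Setoid (G →* SU2) where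
  r ρ σ := ∃ g : SU2, ∀ x : G, σ x = g * ρ x * g⁻¹
  iseqv :=
    { refl := fun _ => ⟨1, by simp⟩
      symm := fun ⟨g, h⟩ => ⟨g⁻¹, fun x => by rw [h]; group⟩
      trans := fun ⟨g, h⟩ ⟨k, h2⟩ => ⟨k * g, fun x => by rw [h2, h]; group⟩ }

/-- The character variety `Hom(G, SU(2))/conj`. -/
def CharVar (G : Type) [Group G] : Type := Quotient (conjSetoid G)

/-- The conjugacy class of a representation. -/
def CharVar.mk {G : Type} [Group G] (ρ : G →* SU2) : CharVar G := Quotient.mk (conjSetoid G) ρ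

/-! ### The surface `F` of genus `n` and the `2n`-punctured sphere `S₀` -/

/-- The standard generators `A_i`, `D_i` of `π₁(F)`. -/
inductive Gen (n : ℕ) : Type
  | A (i : Fin n) : Gen n
  | D (i : Fin n) : Gen n

/-- `A_i` as a word. -/
def a {n : ℕ} (i : Fin n) : FreeGroup (Gen n) := FreeGroup.of (Gen.A i)

/-- `D_i` as a word. -/
def d {n : ℕ} (i : Fin n) : FreeGroup (Gen n) := FreeGroup.of (Gen.D i)

/-- `B_i = D_i A_i D_i⁻¹` as a word. -/
def b {n : ℕ} (i : Fin n) : FreeGroup (Gen n) := d i * a i * (d i)⁻¹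

/-- The commutator `[x, y] = x y x⁻¹ y⁻¹`. -/
def comm {G : Type} [Group G] (x y : G) : G := x * y * x⁻¹ * y⁻¹

/-- The surface relator `[A_1, D_1] ⋯ [A_n, D_n]`. -/
def surfaceRelator (n : ℕ) : FreeGroup (Gen n) :=
  ((List.finRange n).map fun i => comm (a i) (d i)).prod

/-- `π₁(F) = ⟨A_i, D_i | ∏ [A_i, D_i] = 1⟩`. -/
abbrev SurfaceGroup (n : ℕ) : Type := PresentedGroup {surfaceRelator n}

/-- `A_i` as an element of `π₁(F)`. -/
def elemA {n : ℕ} (i : Fin n) : SurfaceGroup n := PresentedGroup.of (Gen.A i)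

/-- `D_i` as an element of `π₁(F)`. -/
def elemD {n : ℕ} (i : Fin n) : SurfaceGroup n := PresentedGroup.of (Gen.D i)

/-- The generators `A_i`, `B_i` of `π₁(S₀)`, the boundary loops of `S₀`. -/
inductive SphereGen (n : ℕ) : Type
  | A (i : Fin n) : SphereGen n
  | B (i : Fin n) : SphereGen n

/-- The relator `∏ A_i B_i⁻¹` of `π₁(S₀)`. -/
def sphereRelator (n : ℕ) : FreeGroup (SphereGen n) :=
  ((List.finRange n).map fun i =>
    FreeGroup.of (SphereGen.A i) * (FreeGroup.of (SphereGen.B i))⁻¹).prod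

/-- `π₁(S₀) = ⟨A_i, B_i | ∏ A_i B_i⁻¹ = 1⟩`. -/
abbrev SphereGroup (n : ℕ) : Type := PresentedGroup {sphereRelator n}

theorem mk_surfaceRelator (n : ℕ) :
    ((List.finRange n).map fun i => comm (elemA i : SurfaceGroup n) (elemD i)).prod = 1 := by
  have h : PresentedGroup.mk {surfaceRelator n} (surfaceRelator n) = 1 :=
    PresentedGroup.one_of_mem (Set.mem_singleton _)
  have e : ∀ R : Set (FreeGroup (Gen n)), PresentedGroup.mk R (surfaceRelator n) =
      ((List.finRange n).map fun i =>
        comm (PresentedGroup.mk R (a i)) (PresentedGroup.mk R (d i))).prod := by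
    intro R
    rw [surfaceRelator, map_list_prod, List.map_map]
    rfl
  rw [e] at h
  exact h

/-- The homomorphism `π₁(S₀) → π₁(F)` induced by inclusion: `A_i ↦ A_i`, `B_i ↦ D_i A_i D_i⁻¹`. -/
def inclusion (n : ℕ) : SphereGroup n →* SurfaceGroup n :=
  PresentedGroup.toGroup
    (f := fun x => match x with
      | SphereGen.A i => elemA i
      | SphereGen.B i => elemD i * elemA i * (elemD i)⁻¹)
    (by
      intro r hr
      rw [Set.mem_singleton_iff.mp hr, sphereRelator, map_list_prod, List.map_map,
        ← mk_surfaceRelator n]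
      refine congrArg List.prod (List.map_congr_left fun i _ => ?_)
      simp [comm, mul_assoc])

/-- The trace map `T([ρ]) = (Re ρ(A_1), …, Re ρ(A_n))`. -/
noncomputable def traceMap {n : ℕ} : CharVar (SurfaceGroup n) → (Fin n → ℝ) :=
  Quotient.lift (s := conjSetoid (SurfaceGroup n)) (fun ρ i => realPart (ρ (elemA i))) (by
    rintro ρ σ ⟨g, h⟩
    funext i
    rw [h, realPart_conj])

/-! ### Curves on `F` and the special perturbation curves -/

/-- The way in which an oriented embedded curve `C ⊂ F` meets the based loop `γ_E * E * γ_E⁻¹`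
of a generator `E`:
* `miss`: `C` is disjoint from `E` and from `γ_E`;
* `loop ε c`: `C` meets `E` transversely in one point, `E · C = ε`, and misses `γ_E`;
* `arc ε c`: `C` misses `E` and meets `γ_E` transversely in one point, with sign `ε`.

The word `c` records how the crossing point is joined to the base point: if `λ` is the chosen
based longitude of `C`, then the longitude of `C` with respect to `E` is `c λ c⁻¹`. -/
inductive Crossing (n : ℕ) : Type
  | miss : Crossing n
  | loop (ε : ℤˣ) (c : FreeGroup (Gen n)) : Crossing n
  | arc (ε : ℤˣ) (c : FreeGroup (Gen n)) : Crossing n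

/-- An oriented embedded curve on `F`, recorded by a longitude (`C` joined to the base point) and
by its intersections with the based loops of the generators. -/
structure Curve (n : ℕ) : Type where
  longitude : FreeGroup (Gen n)
  crossing : Gen n → Crossing n

/-- The longitude `λ_C(E)` of `C` with respect to `E` (trivial, by convention, if `C` misses
`E` and `γ_E`). -/
def Curve.longitudeAt {n : ℕ} (C : Curve n) (E : Gen n) : FreeGroup (Gen n) :=
  match C.crossing E with
  | Crossing.miss => 1
  | Crossing.loop _ c => c * C.longitude * c⁻¹
  | Crossing.arc _ c => c * C.longitude * c⁻¹

/-- The sectors strictly between the `i`-th and the `j`-th one, in counterclockwise (cyclic)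
order: `i + 1, …, j - 1`, read cyclically. -/
def between {n : ℕ} (i j : Fin n) : List (Fin n) :=
  if i < j then (List.finRange n).filter fun l => i < l ∧ l < j
  else ((List.finRange n).filter fun l => i < l) ++ (List.finRange n).filter fun l => l < j

/-- The product of `A_l B_l⁻¹` over `l = i + 1, …, j - 1` in cyclic order. -/
def innerProd {n : ℕ} (i j : Fin n) : FreeGroup (Gen n) :=
  ((between i j).map fun l => a l * (b l)⁻¹).prod

/-- The product of `A_l B_l⁻¹` over `l = i, …, j` in cyclic order. -/
def outerProd {n : ℕ} (i j : Fin n) : FreeGroup (Gen n) :=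
  a i * (b i)⁻¹ * innerProd i j * (a j * (b j)⁻¹)

/-- Intersections of a curve lying in the `i`-th sector. -/
def crossOne {n : ℕ} (i : Fin n) (Ai Di : Crossing n) : Gen n → Crossing n
  | Gen.A l => if l = i then Ai else Crossing.miss
  | Gen.D l => if l = i then Di else Crossing.miss

/-- Intersections of a curve running through the sectors `i` and `j`: with `A_i, D_i, A_j, D_j`
as listed, with `A_l, D_l` as in `inn` if `l` is one of `i + 1, …, j - 1`, and as in `out` if `l`
is one of `j + 1, …, i - 1` (cyclically). -/
def crossTwo {n : ℕ} (i j : Fin n) (Ai Di Aj Dj inn out : Crossing n) : Gen n → Crossing n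
  | Gen.A l => if l = i then Ai else if l = j then Aj else if l ∈ between i j then inn else out
  | Gen.D l => if l = i then Di else if l = j then Dj else if l ∈ between i j then inn else out

/-- The three families of curves in one sector. -/
inductive OneFamily : Type
  | I | II | III

/-- The eight families of curves running through two sectors. -/
inductive TwoFamily : Type
  | IV | V | VI | VII | VIII | IX | X | XI

/-- The set `𝒞` of special perturbation curves: `C_I(i), C_II(i), C_III(i)` and
`C_IV(ij), …, C_XI(ij)` with `i ≠ j`. -/
inductive SpecialCurve (n : ℕ) : Type
  | one (f : OneFamily) (i : Fin n) : SpecialCurve n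
  | two (f : TwoFamily) (i j : Fin n) (h : i ≠ j) : SpecialCurve n

/-- The one-sector curves. -/
def oneData {n : ℕ} (i : Fin n) : OneFamily → Curve n
  | OneFamily.I =>
    { longitude := a i * d i * (a i)⁻¹
      crossing := crossOne i (Crossing.loop (-1) 1) Crossing.miss }
  | OneFamily.II =>
    { longitude := d i * a i * (d i)⁻¹
      crossing := crossOne i Crossing.miss (Crossing.loop 1 1) }
  | OneFamily.III =>
    { longitude := d i * a i
      crossing := crossOne i (Crossing.loop (-1) (a i)) (Crossing.loop 1 1) }

/-- The two-sector curves. The curves IV to VII cross the arcs from the base point to the curves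
in all the other sectors; the curves VIII to XI miss these arcs. -/
def twoData {n : ℕ} (i j : Fin n) : TwoFamily → Curve n
  | TwoFamily.IV =>
    { longitude := (d j)⁻¹ * a i
      crossing := crossTwo i j Crossing.miss (Crossing.loop 1 1) (Crossing.loop 1 1) Crossing.miss
        (Crossing.arc 1 1) (Crossing.arc 1 (a i)) }
  | TwoFamily.V =>
    { longitude := d j * d i
      crossing := crossTwo i j (Crossing.loop (-1) 1) Crossing.miss
        (Crossing.loop (-1) (d i)) Crossing.miss
        (Crossing.arc (-1) (d i)) (Crossing.arc (-1) 1) }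
  | TwoFamily.VI =>
    { longitude := a j * a i * d i
      crossing := crossTwo i j (Crossing.loop (-1) (a i)) (Crossing.loop 1 1)
        Crossing.miss (Crossing.loop 1 (a j)⁻¹)
        (Crossing.arc 1 1) (Crossing.arc 1 (a j)⁻¹) }
  | TwoFamily.VII =>
    { longitude := (d j)⁻¹ * a i * d i
      crossing := crossTwo i j (Crossing.loop (-1) (a i)) (Crossing.loop 1 1)
        (Crossing.loop 1 1) Crossing.miss
        (Crossing.arc 1 1) (Crossing.arc 1 (d j)) }
  | TwoFamily.VIII =>
    { longitude := innerProd i j * (d j)⁻¹ * (outerProd i j)⁻¹ * a i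
      crossing := crossTwo i j Crossing.miss (Crossing.loop 1 1)
        (Crossing.loop 1 (innerProd i j)⁻¹) Crossing.miss Crossing.miss Crossing.miss }
  | TwoFamily.IX =>
    { longitude := innerProd i j * (d j)⁻¹ * (outerProd i j)⁻¹ * a i * d i
      crossing := crossTwo i j (Crossing.loop (-1) (a i)) (Crossing.loop 1 1)
        (Crossing.loop 1 (innerProd i j)⁻¹) Crossing.miss Crossing.miss Crossing.miss }
  | TwoFamily.X =>
    { longitude := outerProd i j * d j * (innerProd i j)⁻¹ * d i
      crossing := crossTwo i j (Crossing.loop (-1) 1) Crossing.miss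
        (Crossing.loop (-1) ((innerProd i j)⁻¹ * d i)) Crossing.miss
        Crossing.miss Crossing.miss }
  | TwoFamily.XI =>
    { longitude := innerProd i j * a j * (outerProd i j)⁻¹ * a i * d i
      crossing := crossTwo i j (Crossing.loop (-1) (a i)) (Crossing.loop 1 1)
        Crossing.miss (Crossing.loop 1 (innerProd i j * a j)⁻¹) Crossing.miss Crossing.miss }

/-- The curve on `F` underlying a special perturbation curve. -/
def SpecialCurve.curve {n : ℕ} : SpecialCurve n → Curve n
  | SpecialCurve.one f i => oneData i f
  | SpecialCurve.two f i j _ => twoData i j f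

/-- The longitudes of the one-sector curves with respect to the generators they intersect. -/
theorem oneData_longitudes {n : ℕ} (i : Fin n) :
    (oneData i .I).longitudeAt (.A i) = a i * d i * (a i)⁻¹ ∧
    (oneData i .II).longitudeAt (.D i) = d i * a i * (d i)⁻¹ ∧
    (oneData i .III).longitudeAt (.D i) = d i * a i ∧
    (oneData i .III).longitudeAt (.A i) = a i * d i := by
  simp [oneData, Curve.longitudeAt, crossOne, mul_assoc]

/-- The longitudes of the two-sector curves with respect to the generators they intersect. -/
theorem twoData_longitudes {n : ℕ} (i j : Fin n) (h : i ≠ j) :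
    (twoData i j .IV).longitudeAt (.D i) = (d j)⁻¹ * a i ∧
    (twoData i j .IV).longitudeAt (.A j) = (d j)⁻¹ * a i ∧
    (twoData i j .V).longitudeAt (.A i) = d j * d i ∧
    (twoData i j .V).longitudeAt (.A j) = d i * d j ∧
    (twoData i j .VI).longitudeAt (.A i) = a i * a j * a i * d i * (a i)⁻¹ ∧
    (twoData i j .VI).longitudeAt (.D i) = a j * a i * d i ∧
    (twoData i j .VI).longitudeAt (.D j) = a i * d i * a j ∧
    (twoData i j .VII).longitudeAt (.D i) = (d j)⁻¹ * a i * d i ∧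
    (twoData i j .VII).longitudeAt (.A i) = a i * (d j)⁻¹ * a i * d i * (a i)⁻¹ ∧
    (twoData i j .VII).longitudeAt (.A j) = (d j)⁻¹ * a i * d i ∧
    (twoData i j .VIII).longitudeAt (.D i)
      = innerProd i j * (d j)⁻¹ * (outerProd i j)⁻¹ * a i ∧
    (twoData i j .VIII).longitudeAt (.A j)
      = (d j)⁻¹ * (outerProd i j)⁻¹ * a i * innerProd i j ∧
    (twoData i j .IX).longitudeAt (.D i)
      = innerProd i j * (d j)⁻¹ * (outerProd i j)⁻¹ * a i * d i ∧
    (twoData i j .IX).longitudeAt (.A j)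
      = (d j)⁻¹ * (outerProd i j)⁻¹ * a i * d i * innerProd i j ∧
    (twoData i j .IX).longitudeAt (.A i)
      = a i * innerProd i j * (d j)⁻¹ * (outerProd i j)⁻¹ * a i * d i * (a i)⁻¹ ∧
    (twoData i j .X).longitudeAt (.A i)
      = outerProd i j * d j * (innerProd i j)⁻¹ * d i ∧
    (twoData i j .X).longitudeAt (.A j)
      = (innerProd i j)⁻¹ * d i * outerProd i j * d j ∧
    (twoData i j .XI).longitudeAt (.D i)
      = innerProd i j * a j * (outerProd i j)⁻¹ * a i * d i ∧
    (twoData i j .XI).longitudeAt (.A i)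
      = a i * innerProd i j * a j * (outerProd i j)⁻¹ * a i * d i * (a i)⁻¹ ∧
    (twoData i j .XI).longitudeAt (.D j)
      = (outerProd i j)⁻¹ * a i * d i * innerProd i j * a j := by
  simp [twoData, Curve.longitudeAt, crossTwo, mul_assoc, h.symm]

/-- The number `K = 3n + 8n(n-1)` of special perturbation curves. -/
def numCurves (n : ℕ) : ℕ := 3 * n + 8 * (n * (n - 1))

/-! ### Perturbed representations of the cylinder `F × [0,1]` -/

/-- Generators of `π₁((F × [0,1]) \ N_C)`, where `N_C` is a tubular neighborhood of
`C × {1/2}`: the loops of `F × {0}`, the loops of `F × {1}` (joined to the base point of `F × {0}`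
along the vertical segment), and a meridian of `N_C`, joined to the base point
in the same way as the longitude of `C`. -/
inductive CylGen (n : ℕ) : Type
  | bot (E : Gen n) : CylGen n
  | top (E : Gen n) : CylGen n
  | mer : CylGen n

/-- A word in the loops of `F × {0}`. -/
def botWord {n : ℕ} (w : FreeGroup (Gen n)) : FreeGroup (CylGen n) := FreeGroup.map CylGen.bot w

/-- A word in the loops of `F × {1}`. -/
def topWord {n : ℕ} (w : FreeGroup (Gen n)) : FreeGroup (CylGen n) := FreeGroup.map CylGen.top w

/-- The meridian of `N_C`, joined to the base point by way of the word `c`. -/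
def merWord {n : ℕ} (c : FreeGroup (Gen n)) : FreeGroup (CylGen n) :=
  botWord c * FreeGroup.of CylGen.mer * (botWord c)⁻¹

/-- The based loop of `E` in `F × {1}`, expressed through the loops of `F × {0}` and the meridian:
pushing the loop down through the level of `C` picks up a meridian at each crossing. -/
def pushWord {n : ℕ} (C : Curve n) (E : Gen n) : FreeGroup (CylGen n) :=
  match C.crossing E with
  | Crossing.miss => FreeGroup.of (CylGen.bot E)
  | Crossing.loop ε c => merWord c ^ (ε : ℤ) * FreeGroup.of (CylGen.bot E)
  | Crossing.arc ε c =>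
    merWord c ^ (ε : ℤ) * FreeGroup.of (CylGen.bot E) * (merWord c ^ (ε : ℤ))⁻¹

/-- The relations of `π₁((F × [0,1]) \ N_C)`: the surface relations of `F × {0}` and `F × {1}`,
commutation of meridian and longitude on the torus `∂N_C`, and the expressions for the loops of
`F × {1}`. -/
def cylRels {n : ℕ} (C : Curve n) : Set (FreeGroup (CylGen n)) :=
  {botWord (surfaceRelator n), topWord (surfaceRelator n),
    comm (FreeGroup.of CylGen.mer) (botWord C.longitude)} ∪
  Set.range fun E => FreeGroup.of (CylGen.top E) * (pushWord C E)⁻¹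

/-- `π₁((F × [0,1]) \ N_C)`. -/
abbrev CylGroup {n : ℕ} (C : Curve n) : Type := PresentedGroup (cylRels C)

/-- The homomorphism induced by the inclusion of `F × {0}`. -/
def botHom {n : ℕ} (C : Curve n) : SurfaceGroup n →* CylGroup C :=
  PresentedGroup.toGroup (f := fun E => PresentedGroup.of (CylGen.bot E)) (by
    intro r hr
    rw [Set.mem_singleton_iff.mp hr]
    have h : PresentedGroup.mk (cylRels C) (botWord (surfaceRelator n)) = 1 :=
      PresentedGroup.one_of_mem (by simp [cylRels])
    rw [← h, botWord, ← MonoidHom.comp_apply]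
    congr 1
    ext x
    simp [PresentedGroup.of])

/-- The homomorphism induced by the inclusion of `F × {1}`. -/
def topHom {n : ℕ} (C : Curve n) : SurfaceGroup n →* CylGroup C :=
  PresentedGroup.toGroup (f := fun E => PresentedGroup.of (CylGen.top E)) (by
    intro r hr
    rw [Set.mem_singleton_iff.mp hr]
    have h : PresentedGroup.mk (cylRels C) (topWord (surfaceRelator n)) = 1 :=
      PresentedGroup.one_of_mem (by simp [cylRels])
    rw [← h, topWord, ← MonoidHom.comp_apply]
    congr 1
    ext x
    simp [PresentedGroup.of])

/-- The meridian in `π₁((F × [0,1]) \ N_C)`. -/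
def meridian {n : ℕ} (C : Curve n) : CylGroup C := PresentedGroup.of CylGen.mer

/-- The longitude in `π₁((F × [0,1]) \ N_C)`. -/
def longitude {n : ℕ} (C : Curve n) : CylGroup C :=
  PresentedGroup.mk (cylRels C) (botWord C.longitude)

/-- Representations of `π₁((F × [0,1]) \ N_C)` which satisfy the perturbation condition
`ρ(μ) = F(ρ(λ))` for the perturbation data `(N_C, t sin α)`. -/
def PerturbedRep {n : ℕ} (C : Curve n) (t : ℝ) : Type :=
  {ρ : CylGroup C →* SU2 // ρ (meridian C) = pertMap t (ρ (longitude C))}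

/-- Conjugacy of perturbed representations. -/
def perturbedSetoid {n : ℕ} (C : Curve n) (t : ℝ) : Setoid (PerturbedRep C t) :=
  (conjSetoid (CylGroup C)).comap Subtype.val

/-- The perturbed character variety of `F × [0,1]`. -/
def PerturbedCharVar {n : ℕ} (C : Curve n) (t : ℝ) : Type := Quotient (perturbedSetoid C t)

/-- Restriction to `F × {0}`. -/
noncomputable def restrictBot {n : ℕ} (C : Curve n) (t : ℝ) : PerturbedCharVar C t → CharVar (SurfaceGroup n) :=
  Quotient.lift (s := perturbedSetoid C t) (fun ρ => CharVar.mk (ρ.1.comp (botHom C))) (by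
    rintro ρ σ ⟨g, h⟩
    exact Quotient.sound (s := conjSetoid (SurfaceGroup n)) ⟨g, fun x => h _⟩)

/-- Restriction to `F × {1}`. -/
noncomputable def restrictTop {n : ℕ} (C : Curve n) (t : ℝ) : PerturbedCharVar C t → CharVar (SurfaceGroup n) :=
  Quotient.lift (s := perturbedSetoid C t) (fun ρ => CharVar.mk (ρ.1.comp (topHom C))) (by
    rintro ρ σ ⟨g, h⟩
    exact Quotient.sound (s := conjSetoid (SurfaceGroup n)) ⟨g, fun x => h _⟩)

/-! ### Restriction to `F × {0}` is a bijection

For each special perturbation curve the surface relation of `F × {1}` follows from the other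
relations, so that every representation of `π₁(F × {0})` extends uniquely to a perturbed
representation. -/

theorem commRules {G : Type} [Group G] {m L : G} (h : m * L = L * m) :
    (m⁻¹ * L = L * m⁻¹) ∧ (m * L⁻¹ = L⁻¹ * m) ∧ (m⁻¹ * L⁻¹ = L⁻¹ * m⁻¹) ∧
    (∀ z, m * (L * z) = L * (m * z)) ∧ (∀ z, m⁻¹ * (L * z) = L * (m⁻¹ * z)) ∧
    (∀ z, m * (L⁻¹ * z) = L⁻¹ * (m * z)) ∧ (∀ z, m⁻¹ * (L⁻¹ * z) = L⁻¹ * (m⁻¹ * z)) := by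
  have c : Commute m L := h
  have h1 := c.inv_left.eq
  have h2 := c.inv_right.eq
  have h3 := c.inv_inv.eq
  refine ⟨h1, h2, h3, fun z => ?_, fun z => ?_, fun z => ?_, fun z => ?_⟩
  · rw [← mul_assoc, h, mul_assoc]
  · rw [← mul_assoc, h1, mul_assoc]
  · rw [← mul_assoc, h2, mul_assoc]
  · rw [← mul_assoc, h3, mul_assoc]

section

variable {G : Type} [Group G] {ai di aj dj W R m L : G}

theorem algI (h : m * L = L * m) (hL : L = ai * di * ai⁻¹) :
    comm (m⁻¹ * ai) di = comm ai di := by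
  obtain rfl : di = ai⁻¹ * L * ai := by rw [hL]; group
  obtain ⟨h1, h2, h3, h4, h5, h6, h7⟩ := commRules h
  simp [comm, mul_assoc, h, h1, h2, h3, h4, h5, h6, h7]

theorem algII (h : m * L = L * m) (hL : L = di * ai * di⁻¹) :
    comm ai (m * di) = comm ai di := by
  obtain rfl : ai = di⁻¹ * L * di := by rw [hL]; group
  obtain ⟨h1, h2, h3, h4, h5, h6, h7⟩ := commRules h
  simp [comm, mul_assoc, h, h1, h2, h3, h4, h5, h6, h7]

theorem algIII (h : m * L = L * m) (hL : L = di * ai) :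
    comm ((ai * m * ai⁻¹)⁻¹ * ai) (m * di) = comm ai di := by
  obtain rfl : di = L * ai⁻¹ := by rw [hL]; group
  obtain ⟨h1, h2, h3, h4, h5, h6, h7⟩ := commRules h
  simp [comm, mul_assoc, h, h1, h2, h3, h4, h5, h6, h7]

theorem algIV (r : comm ai di * W * (comm aj dj * R) = 1) (h : m * L = L * m)
    (hL : L = dj⁻¹ * ai) :
    comm ai (m * di) * (m * W * m⁻¹) *
      (comm (m * aj) dj * (ai * m * ai⁻¹ * R * (ai * m * ai⁻¹)⁻¹)) = 1 := by
  obtain rfl : R = (comm ai di * W * comm aj dj)⁻¹ := by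
    exact (inv_eq_of_mul_eq_one_right (by rw [mul_assoc]; exact r)).symm
  obtain rfl : ai = dj * L := by rw [hL]; group
  obtain ⟨h1, h2, h3, h4, h5, h6, h7⟩ := commRules h
  simp [comm, mul_assoc, h, h1, h2, h3, h4, h5, h6, h7]

theorem algV (r : comm ai di * W * (comm aj dj * R) = 1) (h : m * L = L * m)
    (hL : L = dj * di) :
    comm (m⁻¹ * ai) di * ((di * m * di⁻¹)⁻¹ * W * (di * m * di⁻¹)⁻¹⁻¹) *
      (comm ((di * m * di⁻¹)⁻¹ * aj) dj * (m⁻¹ * R * m⁻¹⁻¹)) = 1 := by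
  obtain rfl : R = (comm ai di * W * comm aj dj)⁻¹ := by
    exact (inv_eq_of_mul_eq_one_right (by rw [mul_assoc]; exact r)).symm
  obtain rfl : dj = L * di⁻¹ := by rw [hL]; group
  obtain ⟨h1, h2, h3, h4, h5, h6, h7⟩ := commRules h
  simp [comm, mul_assoc, h, h1, h2, h3, h4, h5, h6, h7]

theorem algVI (r : comm ai di * W * (comm aj dj * R) = 1) (h : m * L = L * m)
    (hL : L = aj * ai * di) :
    comm ((ai * m * ai⁻¹)⁻¹ * ai) (m * di) * (m * W * m⁻¹) *
      (comm aj (aj⁻¹ * m * aj⁻¹⁻¹ * dj) *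
        (aj⁻¹ * m * aj⁻¹⁻¹ * R * (aj⁻¹ * m * aj⁻¹⁻¹)⁻¹)) = 1 := by
  obtain rfl : R = (comm ai di * W * comm aj dj)⁻¹ := by
    exact (inv_eq_of_mul_eq_one_right (by rw [mul_assoc]; exact r)).symm
  obtain rfl : aj = L * di⁻¹ * ai⁻¹ := by rw [hL]; group
  obtain ⟨h1, h2, h3, h4, h5, h6, h7⟩ := commRules h
  simp [comm, mul_assoc, h, h1, h2, h3, h4, h5, h6, h7]

theorem algVII (r : comm ai di * W * (comm aj dj * R) = 1) (h : m * L = L * m)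
    (hL : L = dj⁻¹ * ai * di) :
    comm ((ai * m * ai⁻¹)⁻¹ * ai) (m * di) * (m * W * m⁻¹) *
      (comm (m * aj) dj * (dj * m * dj⁻¹ * R * (dj * m * dj⁻¹)⁻¹)) = 1 := by
  obtain rfl : R = (comm ai di * W * comm aj dj)⁻¹ := by
    exact (inv_eq_of_mul_eq_one_right (by rw [mul_assoc]; exact r)).symm
  obtain rfl : ai = dj * L * di⁻¹ := by rw [hL]; group
  obtain ⟨h1, h2, h3, h4, h5, h6, h7⟩ := commRules h
  simp [comm, mul_assoc, h, h1, h2, h3, h4, h5, h6, h7]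

theorem algVIII (h : m * L = L * m)
    (hL : L = W * dj⁻¹ * (comm ai di * W * comm aj dj)⁻¹ * ai) :
    comm ai (m * di) * W * (comm (W⁻¹ * m * W⁻¹⁻¹ * aj) dj * R)
      = comm ai di * W * (comm aj dj * R) := by
  obtain rfl : ai = di⁻¹ * (W * aj * dj * aj⁻¹ * W⁻¹) * L * di := by rw [hL, comm, comm]; group
  obtain ⟨h1, h2, h3, h4, h5, h6, h7⟩ := commRules h
  simp [comm, mul_assoc, h, h1, h2, h3, h4, h5, h6, h7]

theorem algIX (h : m * L = L * m)
    (hL : L = W * dj⁻¹ * (comm ai di * W * comm aj dj)⁻¹ * ai * di) :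
    comm ((ai * m * ai⁻¹)⁻¹ * ai) (m * di) * W * (comm (W⁻¹ * m * W⁻¹⁻¹ * aj) dj * R)
      = comm ai di * W * (comm aj dj * R) := by
  obtain rfl : ai = di⁻¹ * (W * aj * dj * aj⁻¹ * W⁻¹) * L := by rw [hL, comm, comm]; group
  obtain ⟨h1, h2, h3, h4, h5, h6, h7⟩ := commRules h
  simp [comm, mul_assoc, h, h1, h2, h3, h4, h5, h6, h7]

theorem algX (h : m * L = L * m)
    (hL : L = comm ai di * W * comm aj dj * dj * W⁻¹ * di) :
    comm (m⁻¹ * ai) di * W * (comm ((W⁻¹ * di * m * (W⁻¹ * di)⁻¹)⁻¹ * aj) dj * R)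
      = comm ai di * W * (comm aj dj * R) := by
  obtain rfl : dj = (ai * di * ai⁻¹ * di⁻¹ * W * aj)⁻¹ * L * di⁻¹ * W * aj := by
    rw [hL, comm, comm]; group
  obtain ⟨h1, h2, h3, h4, h5, h6, h7⟩ := commRules h
  simp [comm, mul_assoc, h, h1, h2, h3, h4, h5, h6, h7]

theorem algXI (h : m * L = L * m)
    (hL : L = W * aj * (comm ai di * W * comm aj dj)⁻¹ * ai * di) :
    comm ((ai * m * ai⁻¹)⁻¹ * ai) (m * di) * W *
      (comm aj ((W * aj)⁻¹ * m * (W * aj)⁻¹⁻¹ * dj) * R)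
      = comm ai di * W * (comm aj dj * R) := by
  obtain rfl : ai = di⁻¹ * (W * aj * dj * aj⁻¹ * dj⁻¹ * aj⁻¹ * W⁻¹) * L := by
    rw [hL, comm, comm]; group
  obtain ⟨h1, h2, h3, h4, h5, h6, h7⟩ := commRules h
  simp [comm, mul_assoc, h, h1, h2, h3, h4, h5, h6, h7]
end

theorem mem_split {n : ℕ} (i : Fin n) (l : List (Fin n)) (hl : l.Pairwise (· < ·)) (hi : i ∈ l) :
    l = l.filter (fun k => k < i) ++ i :: l.filter (fun k => i < k) := by
  induction l with
  | nil => simp at hi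
  | cons x l ih =>
    rw [List.pairwise_cons] at hl
    rcases List.mem_cons.mp hi with rfl | h
    · have h1 : l.filter (fun k => k < i) = [] := by
        simp only [List.filter_eq_nil_iff, decide_eq_true_eq, not_lt]
        exact fun k hk => (hl.1 k hk).le
      have h2 : l.filter (fun k => i < k) = l := by
        simp only [List.filter_eq_self, decide_eq_true_eq]
        exact hl.1
      simp [h1, h2]
    · have hx := hl.1 i h
      have := ih hl.2 h
      simp [hx, hx.not_gt]
      exact this

theorem prod_split {G : Type} [Group G] {n : ℕ} (f : Fin n → G) (i j : Fin n) (h : i ≠ j) :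
    ((List.finRange n).map f).prod = 1 ↔
      f i * ((between i j).map f).prod * (f j * ((between j i).map f).prod) = 1 := by
  have key : ∀ i j : Fin n, i < j → (((List.finRange n).map f).prod = 1 ↔
      f i * ((between i j).map f).prod * (f j * ((between j i).map f).prod) = 1) := by
    intro i j hij
    have hp := List.pairwise_lt_finRange n
    have e1 := mem_split i _ hp (List.mem_finRange i)
    have e2 := mem_split j _ (hp.filter (fun k => i < k)) (by simp [hij])
    rw [List.filter_filter, List.filter_filter] at e2
    have b1 : between i j = (List.finRange n).filter (fun k => decide (k < j) && decide (i < k)) := by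
      rw [between, if_pos hij]
      apply List.filter_congr
      intro k _
      rw [Bool.decide_and, Bool.and_comm]
    have b2 : between j i = (List.finRange n).filter (fun k => decide (j < k) && decide (i < k)) ++
        (List.finRange n).filter (fun k => k < i) := by
      rw [between, if_neg hij.not_gt]
      congr 1
      apply List.filter_congr
      intro k _
      by_cases hk : j < k
      · simp [hk, hij.trans hk]
      · simp [hk]
    rw [e2, ← b1] at e1
    conv_lhs => rw [e1]
    rw [b2]
    simp only [List.map_append, List.map_cons, List.prod_append, List.prod_cons]
    generalize ((between i j).map f).prod = W
    generalize (((List.finRange n).filter fun k => k < i).map f).prod = X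
    rw [mul_eq_one_iff_eq_inv, eq_comm, inv_eq_iff_mul_eq_one]
    simp only [mul_assoc]
  rcases lt_or_gt_of_ne h with h | h
  · exact key i j h
  · rw [key j i h, mul_eq_one_iff_eq_inv, eq_comm, inv_eq_iff_mul_eq_one]

theorem not_mem_between {n : ℕ} (i j l : Fin n) (h : i ≠ j) (hl : l ∈ between j i) :
    l ≠ i ∧ l ≠ j ∧ l ∉ between i j := by
  unfold between at *
  rcases lt_or_gt_of_ne h with h | h
  · rw [if_pos h]
    rw [if_neg h.not_gt] at hl
    simp only [List.mem_append, List.mem_filter, List.mem_finRange, true_and,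
      decide_eq_true_eq] at hl ⊢
    grind
  · rw [if_neg h.not_gt]
    rw [if_pos h] at hl
    simp only [List.mem_append, List.mem_filter, List.mem_finRange, true_and,
      decide_eq_true_eq] at hl ⊢
    grind

theorem mem_between {n : ℕ} (i j l : Fin n) (h : i ≠ j) (hl : l ∈ between i j) :
    l ≠ i ∧ l ≠ j := by
  have := not_mem_between j i l h.symm hl
  exact ⟨this.2.1, this.1⟩

/-- The value on the loop of `E` in `F × {1}` determined by values on the loops of `F × {0}` and
on the meridian. -/
def pushVal {G : Type} [Group G] {n : ℕ} (x : Gen n → G) (m : G) (C : Curve n) (E : Gen n) : G :=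
  match C.crossing E with
  | Crossing.miss => x E
  | Crossing.loop ε c => (FreeGroup.lift x c * m * (FreeGroup.lift x c)⁻¹) ^ (ε : ℤ) * x E
  | Crossing.arc ε c => (FreeGroup.lift x c * m * (FreeGroup.lift x c)⁻¹) ^ (ε : ℤ) * x E *
      ((FreeGroup.lift x c * m * (FreeGroup.lift x c)⁻¹) ^ (ε : ℤ))⁻¹

/-- The commutators `[x(A_i), x(D_i)]`. -/
def genComm {G : Type} [Group G] {n : ℕ} (x : Gen n → G) (i : Fin n) : G :=
  comm (x (Gen.A i)) (x (Gen.D i))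

theorem lift_comm_prod {G : Type} [Group G] {n : ℕ} (x : Gen n → G) (l : List (Fin n)) :
    FreeGroup.lift x (l.map fun i => a i * (b i)⁻¹).prod = (l.map (genComm x)).prod := by
  rw [map_list_prod, List.map_map]
  refine congrArg List.prod (List.map_congr_left fun i _ => ?_)
  simp [genComm, comm, a, b, d, mul_assoc]

theorem prod_conj {G : Type} [Group G] {n : ℕ} (f f2 : Fin n → G) (g : G) (l : List (Fin n))
    (h : ∀ k ∈ l, f2 k = g * f k * g⁻¹) : (l.map f2).prod = g * (l.map f).prod * g⁻¹ := by
  induction l with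
  | nil => simp
  | cons k l ih =>
    rw [List.map_cons, List.prod_cons, List.map_cons, List.prod_cons, h k (by simp),
      ih fun k hk => h k (by simp [hk])]
    group

theorem top_relation {G : Type} [Group G] {n : ℕ} (x : Gen n → G) (m : G) (C : SpecialCurve n)
    (hx : ((List.finRange n).map (genComm x)).prod = 1)
    (hm : m * FreeGroup.lift x C.curve.longitude = FreeGroup.lift x C.curve.longitude * m) :
    ((List.finRange n).map (genComm (pushVal x m C.curve))).prod = 1 := by
  cases C with
  | one f i =>
    rw [← hx]
    refine congrArg List.prod (List.map_congr_left fun l _ => ?_)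
    by_cases hl : l = i
    · subst hl
      cases f
      · simpa [genComm, pushVal, SpecialCurve.curve, oneData, crossOne, a, d] using
          algI hm (by simp [SpecialCurve.curve, oneData, a, d])
      · simpa [genComm, pushVal, SpecialCurve.curve, oneData, crossOne, a, d] using
          algII hm (by simp [SpecialCurve.curve, oneData, a, d])
      · simpa [genComm, pushVal, SpecialCurve.curve, oneData, crossOne, a, d] using
          algIII hm (by simp [SpecialCurve.curve, oneData, a, d])
    · cases f <;> simp [genComm, pushVal, SpecialCurve.curve, oneData, crossOne, hl]
  | two f i j h =>
    have hji : j ≠ i := h.symm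
    rw [prod_split _ i j h] at hx ⊢
    have hW : FreeGroup.lift x (innerProd i j) = ((between i j).map (genComm x)).prod :=
      lift_comm_prod x _
    have hP : FreeGroup.lift x (outerProd i j) =
        genComm x i * ((between i j).map (genComm x)).prod * genComm x j := by
      rw [outerProd, map_mul, map_mul, hW]
      have e := fun k => lift_comm_prod x [k]
      simp only [List.map_cons, List.map_nil, List.prod_cons, List.prod_nil, mul_one] at e
      rw [e, e]
    have hin : ∀ l ∈ between i j, l ≠ i ∧ l ≠ j := fun l hl => mem_between i j l h hl
    have hout : ∀ l ∈ between j i, l ≠ i ∧ l ≠ j ∧ l ∉ between i j :=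
      fun l hl => not_mem_between i j l h hl
    have conj : ∀ (g u v : G), comm (g * u * g⁻¹) (g * v * g⁻¹) = g * comm u v * g⁻¹ := by
      intro g u v; simp [comm, mul_assoc]
    have hcin : ∀ (C : Curve n) (g : G), (∀ l ∈ between i j,
        pushVal x m C (Gen.A l) = g * x (Gen.A l) * g⁻¹ ∧
        pushVal x m C (Gen.D l) = g * x (Gen.D l) * g⁻¹) →
        ((between i j).map (genComm (pushVal x m C))).prod
          = g * ((between i j).map (genComm x)).prod * g⁻¹ := fun C g hC =>
      prod_conj _ _ g _ fun l hl => by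
        rw [genComm, (hC l hl).1, (hC l hl).2, conj, genComm]
    have hcout : ∀ (C : Curve n) (g : G), (∀ l ∈ between j i,
        pushVal x m C (Gen.A l) = g * x (Gen.A l) * g⁻¹ ∧
        pushVal x m C (Gen.D l) = g * x (Gen.D l) * g⁻¹) →
        ((between j i).map (genComm (pushVal x m C))).prod
          = g * ((between j i).map (genComm x)).prod * g⁻¹ := fun C g hC =>
      prod_conj _ _ g _ fun l hl => by
        rw [genComm, (hC l hl).1, (hC l hl).2, conj, genComm]
    set W := ((between i j).map (genComm x)).prod with hWdef
    set R := ((between j i).map (genComm x)).prod with hRdef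
    have fin : ∀ (C : Curve n) (g k : G),
        (∀ l ∈ between i j,
          pushVal x m C (Gen.A l) = g * x (Gen.A l) * g⁻¹ ∧
          pushVal x m C (Gen.D l) = g * x (Gen.D l) * g⁻¹) →
        (∀ l ∈ between j i,
          pushVal x m C (Gen.A l) = k * x (Gen.A l) * k⁻¹ ∧
          pushVal x m C (Gen.D l) = k * x (Gen.D l) * k⁻¹) →
        genComm (pushVal x m C) i * (g * W * g⁻¹) *
          (genComm (pushVal x m C) j * (k * R * k⁻¹)) = 1 →
        genComm (pushVal x m C) i * ((between i j).map (genComm (pushVal x m C))).prod *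
          (genComm (pushVal x m C) j * ((between j i).map (genComm (pushVal x m C))).prod)
          = 1 := by
      intro C g k h1 h2 h3
      rw [hcin C g h1, hcout C k h2]
      exact h3
    cases f
    · refine fin _ m (x (Gen.A i) * m * (x (Gen.A i))⁻¹) ?_ ?_ ?_
      · intro l hl
        simp [pushVal, SpecialCurve.curve, twoData, crossTwo, hin l hl, hl]
      · intro l hl
        simp [pushVal, SpecialCurve.curve, twoData, crossTwo, hout l hl, a]
      · have := algIV hx hm (by simp [SpecialCurve.curve, twoData, a, d])
        simpa [genComm, pushVal, SpecialCurve.curve, twoData, crossTwo, a, d, hji] using this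
    · refine fin _ (x (Gen.D i) * m * (x (Gen.D i))⁻¹)⁻¹ m⁻¹ ?_ ?_ ?_
      · intro l hl
        simp [pushVal, SpecialCurve.curve, twoData, crossTwo, hin l hl, hl, d]
      · intro l hl
        simp [pushVal, SpecialCurve.curve, twoData, crossTwo, hout l hl]
      · have := algV hx hm (by simp [SpecialCurve.curve, twoData, a, d])
        simpa [genComm, pushVal, SpecialCurve.curve, twoData, crossTwo, a, d, hji] using this
    · refine fin _ m ((x (Gen.A j))⁻¹ * m * (x (Gen.A j))⁻¹⁻¹) ?_ ?_ ?_
      · intro l hl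
        simp [pushVal, SpecialCurve.curve, twoData, crossTwo, hin l hl, hl]
      · intro l hl
        simp [pushVal, SpecialCurve.curve, twoData, crossTwo, hout l hl, a]
      · have := algVI hx hm (by simp [SpecialCurve.curve, twoData, a, d])
        simpa [genComm, pushVal, SpecialCurve.curve, twoData, crossTwo, a, d, hji] using this
    · refine fin _ m (x (Gen.D j) * m * (x (Gen.D j))⁻¹) ?_ ?_ ?_
      · intro l hl
        simp [pushVal, SpecialCurve.curve, twoData, crossTwo, hin l hl, hl]
      · intro l hl
        simp [pushVal, SpecialCurve.curve, twoData, crossTwo, hout l hl, d]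
      · have := algVII hx hm (by simp [SpecialCurve.curve, twoData, a, d])
        simpa [genComm, pushVal, SpecialCurve.curve, twoData, crossTwo, a, d, hji] using this
    all_goals
      refine fin _ 1 1 ?_ ?_ ?_
      · intro l hl
        simp [pushVal, SpecialCurve.curve, twoData, crossTwo, hin l hl, hl]
      · intro l hl
        simp [pushVal, SpecialCurve.curve, twoData, crossTwo, hout l hl]
      refine Eq.trans ?_ hx
    · have := algVIII (ai := x (Gen.A i)) (di := x (Gen.D i)) (aj := x (Gen.A j))
        (dj := x (Gen.D j)) (W := W) (R := R) hm (by
        simp only [SpecialCurve.curve, twoData, map_mul, map_inv, hW, hP]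
        simp only [genComm, a, d, FreeGroup.lift_apply_of])
      simpa [genComm, pushVal, SpecialCurve.curve, twoData, crossTwo, a, d, hji, hW] using this
    · have := algIX (ai := x (Gen.A i)) (di := x (Gen.D i)) (aj := x (Gen.A j))
        (dj := x (Gen.D j)) (W := W) (R := R) hm (by
        simp only [SpecialCurve.curve, twoData, map_mul, map_inv, hW, hP]
        simp only [genComm, a, d, FreeGroup.lift_apply_of])
      simpa [genComm, pushVal, SpecialCurve.curve, twoData, crossTwo, a, d, hji, hW] using this
    · have := algX (ai := x (Gen.A i)) (di := x (Gen.D i)) (aj := x (Gen.A j))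
        (dj := x (Gen.D j)) (W := W) (R := R) hm (by
        simp only [SpecialCurve.curve, twoData, map_mul, map_inv, hW, hP]
        simp only [genComm, a, d, FreeGroup.lift_apply_of])
      simpa [genComm, pushVal, SpecialCurve.curve, twoData, crossTwo, a, d, hji, hW] using this
    · have := algXI (ai := x (Gen.A i)) (di := x (Gen.D i)) (aj := x (Gen.A j))
        (dj := x (Gen.D j)) (W := W) (R := R) hm (by
        simp only [SpecialCurve.curve, twoData, map_mul, map_inv, hW, hP]
        simp only [genComm, a, d, FreeGroup.lift_apply_of])
      simpa [genComm, pushVal, SpecialCurve.curve, twoData, crossTwo, a, d, hji, hW] using this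

/-- Values of a representation of `π₁((F × [0,1]) \ N_C)` on the generators, given its values `x`
on the loops of `F × {0}` and `m` on the meridian. -/
def cylVal {G : Type} [Group G] {n : ℕ} (x : Gen n → G) (m : G) (C : Curve n) : CylGen n → G
  | CylGen.bot E => x E
  | CylGen.top E => pushVal x m C E
  | CylGen.mer => m

theorem lift_botWord {G : Type} [Group G] {n : ℕ} (v : CylGen n → G) (w : FreeGroup (Gen n)) :
    FreeGroup.lift v (botWord w) = FreeGroup.lift (fun E => v (CylGen.bot E)) w := by
  rw [botWord, ← MonoidHom.comp_apply]
  congr 1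
  ext x
  simp

theorem lift_topWord {G : Type} [Group G] {n : ℕ} (v : CylGen n → G) (w : FreeGroup (Gen n)) :
    FreeGroup.lift v (topWord w) = FreeGroup.lift (fun E => v (CylGen.top E)) w := by
  rw [topWord, ← MonoidHom.comp_apply]
  congr 1
  ext x
  simp

theorem lift_surfaceRelator {G : Type} [Group G] {n : ℕ} (x : Gen n → G) :
    FreeGroup.lift x (surfaceRelator n) = ((List.finRange n).map (genComm x)).prod := by
  rw [surfaceRelator, map_list_prod, List.map_map]
  refine congrArg List.prod (List.map_congr_left fun i _ => ?_)
  simp [genComm, comm, a, d]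

theorem lift_pushWord {G : Type} [Group G] {n : ℕ} (v : CylGen n → G) (C : Curve n) (E : Gen n) :
    FreeGroup.lift v (pushWord C E) =
      pushVal (fun E => v (CylGen.bot E)) (v CylGen.mer) C E := by
  unfold pushWord pushVal
  split <;> simp [merWord, lift_botWord]

theorem cylVal_rels {G : Type} [Group G] {n : ℕ} (x : Gen n → G) (m : G) (C : SpecialCurve n)
    (hx : FreeGroup.lift x (surfaceRelator n) = 1)
    (hm : m * FreeGroup.lift x C.curve.longitude = FreeGroup.lift x C.curve.longitude * m) :
    ∀ r ∈ cylRels C.curve, FreeGroup.lift (cylVal x m C.curve) r = 1 := by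
  rintro r ((rfl | rfl | rfl) | ⟨E, rfl⟩)
  · rw [lift_botWord]; exact hx
  · rw [lift_topWord, lift_surfaceRelator]
    exact top_relation x m C ((lift_surfaceRelator x).symm.trans hx) hm
  · simp only [comm, map_mul, map_inv, lift_botWord, FreeGroup.lift_apply_of, cylVal]
    rw [hm]; group
  · rw [map_mul, map_inv, lift_pushWord, FreeGroup.lift_apply_of]
    simp [cylVal]

theorem map_mk_eq_lift {G : Type} [Group G] {α : Type} {R : Set (FreeGroup α)}
    (ρ : PresentedGroup R →* G) (w : FreeGroup α) :
    ρ (PresentedGroup.mk R w) = FreeGroup.lift (fun x => ρ (PresentedGroup.of x)) w := by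
  rw [← MonoidHom.comp_apply]
  congr 1
  ext x
  simp [PresentedGroup.of]

theorem top_value {G : Type} [Group G] {n : ℕ} (C : Curve n) (ρ : CylGroup C →* G) (E : Gen n) :
    ρ (PresentedGroup.of (CylGen.top E)) =
      pushVal (fun E => ρ (PresentedGroup.of (CylGen.bot E))) (ρ (meridian C)) C E := by
  have h : PresentedGroup.mk (cylRels C)
      (FreeGroup.of (CylGen.top E) * (pushWord C E)⁻¹) = 1 :=
    PresentedGroup.one_of_mem (Or.inr ⟨E, rfl⟩)
  have h2 := congrArg ρ h
  rw [map_one, map_mk_eq_lift, map_mul, map_inv, mul_inv_eq_one, lift_pushWord,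
    FreeGroup.lift_apply_of] at h2
  exact h2

theorem pushVal_conj {n : ℕ} (x : Gen n → SU2) (m g : SU2) (C : Curve n) (E : Gen n) :
    pushVal (fun E => g * x E * g⁻¹) (g * m * g⁻¹) C E = g * pushVal x m C E * g⁻¹ := by
  have h : ∀ w, FreeGroup.lift (fun E => g * x E * g⁻¹) w = g * FreeGroup.lift x w * g⁻¹ := by
    intro w
    have : FreeGroup.lift (fun E => g * x E * g⁻¹)
        = (MulAut.conj g).toMonoidHom.comp (FreeGroup.lift x) := by ext1 E; simp
    rw [this]
    simp
  have hp : ∀ (u : SU2) (k : ℤ), (g * u * g⁻¹) ^ k = g * u ^ k * g⁻¹ := fun u k => conj_zpow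
  have hq : ∀ c, (g * FreeGroup.lift x c * g⁻¹) * (g * m * g⁻¹) *
      (g * FreeGroup.lift x c * g⁻¹)⁻¹
      = g * (FreeGroup.lift x c * m * (FreeGroup.lift x c)⁻¹) * g⁻¹ := by
    intro c; group
  unfold pushVal
  split
  · rfl
  · rw [h, hq, hp]; group
  · rw [h, hq, hp]; group

/-- Restriction to `F × {0}` is a bijection from the perturbed character variety of `F × [0,1]` to
the character variety of `F`, for every special perturbation curve. -/
theorem restrictBot_bijective {n : ℕ} (C : SpecialCurve n) (t : ℝ) :
    Function.Bijective (restrictBot C.curve t) := by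
  constructor
  · rintro ⟨ρ, hρ⟩ ⟨σ, hσ⟩ h
    obtain ⟨g, hg⟩ := Quotient.exact (s := conjSetoid (SurfaceGroup n)) h
    refine Quotient.sound (s := perturbedSetoid C.curve t) ⟨g, ?_⟩
    have hb : ∀ E, σ (PresentedGroup.of (CylGen.bot E))
        = g * ρ (PresentedGroup.of (CylGen.bot E)) * g⁻¹ := by
      intro E
      have := hg (PresentedGroup.of E)
      simpa [botHom] using this
    have hl : σ (longitude C.curve) = g * ρ (longitude C.curve) * g⁻¹ := by
      rw [longitude, map_mk_eq_lift, map_mk_eq_lift, lift_botWord, lift_botWord]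
      have e : FreeGroup.lift (fun E => σ (PresentedGroup.of (CylGen.bot E)))
          = (MulAut.conj g).toMonoidHom.comp
            (FreeGroup.lift fun E => ρ (PresentedGroup.of (CylGen.bot E))) := by
        ext1 E; simp [hb]
      rw [e]; simp
    have hm : σ (meridian C.curve) = g * ρ (meridian C.curve) * g⁻¹ := by
      rw [hσ, hρ, hl, pertMap_conj]
    have e : σ = (MulAut.conj g).toMonoidHom.comp ρ := by
      refine PresentedGroup.ext fun y => ?_
      cases y with
      | bot E => simpa using hb E
      | top E =>
        have : (fun E => σ (PresentedGroup.of (CylGen.bot E)))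
          = fun E => g * ρ (PresentedGroup.of (CylGen.bot E)) * g⁻¹ := funext hb
        simp only [MonoidHom.comp_apply]
        rw [top_value, top_value, hm, this, pushVal_conj]
        rfl
      | mer => exact hm
    intro x
    change σ x = _
    rw [e]; rfl
  · rintro ⟨ρ⟩
    set x : Gen n → SU2 := fun E => ρ (PresentedGroup.of E) with hx
    set m : SU2 := pertMap t (FreeGroup.lift x C.curve.longitude) with hm
    have h1 : FreeGroup.lift x (surfaceRelator n) = 1 := by
      rw [hx, ← map_mk_eq_lift, PresentedGroup.one_of_mem (Set.mem_singleton _), map_one]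
    have hr := cylVal_rels x m C h1 (pertMap_commute _ _).eq
    have hof : ∀ y, PresentedGroup.toGroup hr (PresentedGroup.of y) = cylVal x m C.curve y :=
      fun y => PresentedGroup.toGroup.of hr
    refine ⟨Quotient.mk (perturbedSetoid C.curve t) ⟨PresentedGroup.toGroup hr, ?_⟩, ?_⟩
    · rw [meridian, longitude, map_mk_eq_lift, hof, lift_botWord]
      simp only [hof]
      rfl
    · change CharVar.mk _ = CharVar.mk ρ
      congr 1
      refine PresentedGroup.ext fun E => ?_
      simp [botHom, hof, cylVal, hx]

/-! ### The perturbation maps -/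

/-- The map `Φ_{π_C} : M(F) → M(F)` for the perturbation data `π_C = (N_C, t sin α)`: the inverse
of the restriction of `M_{π_C}(F × [0,1])` to `F × {0}`, followed by the restriction
to `F × {1}`. -/
noncomputable def perturb {n : ℕ} (C : SpecialCurve n) (t : ℝ) (x : CharVar (SurfaceGroup n)) :
    CharVar (SurfaceGroup n) :=
  restrictTop C.curve t ((Equiv.ofBijective _ (restrictBot_bijective C t)).symm x)

/-- The map `Φ_C(x, t) = Φ_{t_K, C_K} ∘ ⋯ ∘ Φ_{t_1, C_1} (x)` of an ordered list
`C = (C_1, …, C_K)` of curves and parameters `t = (t_1, …, t_K)`: the curve `C_k` is pushed to the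
level `k/(K+1)` of `F × [0,1]`. -/
noncomputable def perturbAll {n K : ℕ} (C : Fin K → SpecialCurve n) (x : CharVar (SurfaceGroup n))
    (t : Fin K → ℝ) : CharVar (SurfaceGroup n) :=
  (List.finRange K).foldl (fun y k => perturb (C k) (t k) y) x

/-- The set `𝒞` has `K = 3n + 8n(n-1)` elements. -/
theorem card_specialCurve (n : ℕ) : Nat.card (SpecialCurve n) = numCurves n := by
  let e1 : OneFamily ≃ Fin 3 :=
    { toFun := fun f => match f with | .I => 0 | .II => 1 | .III => 2
      invFun := fun k => match k with | 0 => .I | 1 => .II | 2 => .III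
      left_inv := by rintro (_ | _) <;> rfl
      right_inv := by intro k; fin_cases k <;> rfl }
  let e2 : TwoFamily ≃ Fin 8 :=
    { toFun := fun f => match f with
        | .IV => 0 | .V => 1 | .VI => 2 | .VII => 3 | .VIII => 4 | .IX => 5 | .X => 6 | .XI => 7
      invFun := fun k => match k with
        | 0 => .IV | 1 => .V | 2 => .VI | 3 => .VII | 4 => .VIII | 5 => .IX | 6 => .X | 7 => .XI
      left_inv := by rintro (_ | _) <;> rfl
      right_inv := by intro k; fin_cases k <;> rfl }
  let e : SpecialCurve n ≃
      (OneFamily × Fin n) ⊕ (TwoFamily × {p : Fin n × Fin n // p.1 ≠ p.2}) :=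
    { toFun := fun c => match c with
        | .one f i => Sum.inl (f, i)
        | .two f i j h => Sum.inr (f, ⟨(i, j), h⟩)
      invFun := fun s => match s with
        | .inl p => .one p.1 p.2
        | .inr p => .two p.1 p.2.1.1 p.2.1.2 p.2.2
      left_inv := by rintro (_ | _) <;> rfl
      right_inv := by rintro (_ | _) <;> rfl }
  have hoff : Nat.card {p : Fin n × Fin n // p.1 ≠ p.2} = n * (n - 1) := by
    rw [Nat.card_eq_fintype_card, Fintype.card_subtype]
    have : (Finset.univ.filter fun p : Fin n × Fin n => p.1 ≠ p.2)
        = (Finset.univ : Finset (Fin n)).offDiag := by ext p; simp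
    rw [this, Finset.offDiag_card]
    simp [Nat.mul_sub]
  have : Finite OneFamily := Finite.of_equiv _ e1.symm
  have : Finite TwoFamily := Finite.of_equiv _ e2.symm
  rw [Nat.card_congr e, Nat.card_sum, Nat.card_prod, Nat.card_prod, Nat.card_congr e1,
    Nat.card_congr e2, hoff, numCurves]
  simp

end TangleSurface

/-! It suffices to hit each standard basis vector of `Fin n → ℝ` by the differential at 0. On values
at generators a perturbation is explicit (`perturb_mk`): a loop crossing multiplies the value by a
conjugate of the meridian or its inverse, and an arc crossing conjugates it, which leaves its real
part alone. With all other parameters zero only one curve acts, so the ordering is invisible to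
first order. Since `Re ρ(A_l) = 0`, the partial derivative of `Re ρ(A_l)` along a curve C crossing
`A_l` is `±Re(λ_C(A_l) A_l)`, the number `slope` (`hasDerivAt_flow`, `exists_hasFDerivAt_traceMap`).

Fix i. Six families contain curves whose only loop crossing with an A-generator is with `A_i`: I(i),
III(i), VI(ij), XI(ij), IV(ji) and VIII(ji). If one of them has nonzero slope at `A_i`, the i-th
basis vector is in the range. Otherwise:

I and III give `Re(A_i D_i) = Re D_i = 0`, so that `A_i`, `D_i`, `A_i D_i` form an orthonormal basis
of the imaginary quaternions and `[A_i, D_i] = -1`.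

VI and IV make each `A_j` orthogonal to `D_i` and `A_i D_i`, hence a multiple of `A_i`.

XI and VIII, together with the surface relation, give the same for the conjugate of `B_j` by `W
A_j`, where W is the product of the `A_l B_l⁻¹` strictly between i and j. Induction along the cyclic
order starting after i then removes the conjugation (`mem_centralizer_of_slope`).

Thus `ρ(A_i)` commutes with the image of `π₁(S₀)`. Irreducibility there forces `ρ(A_i) = ±1`,
contradicting `Re ρ(A_i) = 0`. -/

namespace TangleSurface

/-! ### The perturbation maps on values of generators -/

/-- The perturbation map of a curve, acting on the values of a representation on generators. -/
noncomputable def flow {n : ℕ} (C : Curve n) (t : ℝ) (x : Gen n → SU2) : Gen n → SU2 :=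
  pushVal x (pertMap t (FreeGroup.lift x C.longitude)) C

/-- The explicit extension of ρ over the cylinder restricts to ρ at the bottom, so by bijectivity it
is the one selected by `perturb`. This replaces conjugacy classes by quaternion-valued functions, to
which calculus applies. -/
theorem perturb_mk {n : ℕ} (C : SpecialCurve n) (t : ℝ) (ρ : SurfaceGroup n →* SU2) :
    ∃ σ : SurfaceGroup n →* SU2, perturb C t (CharVar.mk ρ) = CharVar.mk σ ∧
      (fun E => σ (PresentedGroup.of E)) =
        flow C.curve t (fun E => ρ (PresentedGroup.of E)) := by
  set x : Gen n → SU2 := fun E => ρ (PresentedGroup.of E) with hx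
  set m : SU2 := pertMap t (FreeGroup.lift x C.curve.longitude) with hm
  have h1 : FreeGroup.lift x (surfaceRelator n) = 1 := by
    rw [hx, ← map_mk_eq_lift, PresentedGroup.one_of_mem (Set.mem_singleton _), map_one]
  have hr := cylVal_rels x m C h1 (pertMap_commute _ _).eq
  have hof : ∀ y, PresentedGroup.toGroup hr (PresentedGroup.of y) = cylVal x m C.curve y :=
    fun y => PresentedGroup.toGroup.of hr
  have hτ : PresentedGroup.toGroup hr (meridian C.curve) =
      pertMap t (PresentedGroup.toGroup hr (longitude C.curve)) := by
    rw [meridian, longitude, map_mk_eq_lift, hof, lift_botWord]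
    simp only [hof]
    rfl
  let y : PerturbedCharVar C.curve t :=
    Quotient.mk (perturbedSetoid C.curve t) ⟨PresentedGroup.toGroup hr, hτ⟩
  have hy : restrictBot C.curve t y = CharVar.mk ρ := by
    change CharVar.mk _ = CharVar.mk ρ
    congr 1
    refine PresentedGroup.ext fun E => ?_
    simp [botHom, hof, cylVal, hx]
  have hy2 : (Equiv.ofBijective _ (restrictBot_bijective C t)).symm (CharVar.mk ρ) = y := by
    rw [Equiv.symm_apply_eq]
    exact hy.symm
  refine ⟨(PresentedGroup.toGroup hr).comp (topHom C.curve), ?_, ?_⟩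
  · rw [perturb, hy2]
    rfl
  · funext E
    simp only [MonoidHom.comp_apply, topHom, PresentedGroup.toGroup.of, hof]
    rfl

theorem foldl_perturb_mk {n K : ℕ} (C : Fin K → SpecialCurve n) (t : Fin K → ℝ)
    (l : List (Fin K)) (ρ : SurfaceGroup n →* SU2) :
    ∃ σ : SurfaceGroup n →* SU2,
      l.foldl (fun y k => perturb (C k) (t k) y) (CharVar.mk ρ) = CharVar.mk σ ∧
      (fun E => σ (PresentedGroup.of E)) =
        l.foldl (fun x k => flow (C k).curve (t k) x) (fun E => ρ (PresentedGroup.of E)) := by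
  induction l generalizing ρ with
  | nil => exact ⟨ρ, rfl, rfl⟩
  | cons k l ih =>
    obtain ⟨τ, h1, h2⟩ := perturb_mk (C k) (t k) ρ
    obtain ⟨σ, h3, h4⟩ := ih τ
    refine ⟨σ, ?_, ?_⟩
    · rw [List.foldl_cons, h1, h3]
    · rw [List.foldl_cons, h4, h2]

theorem traceMap_perturbAll {n K : ℕ} (C : Fin K → SpecialCurve n) (t : Fin K → ℝ)
    (ρ : SurfaceGroup n →* SU2) (i : Fin n) :
    traceMap (perturbAll C (CharVar.mk ρ) t) i =
      realPart ((List.finRange K).foldl (fun x k => flow (C k).curve (t k) x)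
        (fun E => ρ (PresentedGroup.of E)) (Gen.A i)) := by
  obtain ⟨σ, h1, h2⟩ := foldl_perturb_mk C t (List.finRange K) ρ
  rw [perturbAll, h1, ← h2]
  rfl

theorem pertMap_zero (q : SU2) : pertMap 0 q = 1 := by
  apply Subtype.ext
  simp [pertMap, NormedSpace.exp_zero]

theorem pertMap_neg (t : ℝ) (q : SU2) : pertMap (-t) q = (pertMap t q)⁻¹ := by
  apply Subtype.ext
  change _ = star (NormedSpace.exp (t • (q : Quaternion ℝ).im))
  rw [NormedSpace.star_exp]
  simp only [pertMap]
  congr 1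
  ext <;> simp

theorem flow_zero {n : ℕ} (C : Curve n) (x : Gen n → SU2) : flow C 0 x = x := by
  funext E
  simp only [flow, pertMap_zero, pushVal]
  split <;> simp

/-- Every curve with parameter 0 acts as the identity, so along a coordinate axis the order of
composition does not matter. -/
theorem foldl_flow_single {n K : ℕ} (C : Fin K → SpecialCurve n) (k : Fin K) (s : ℝ)
    (x : Gen n → SU2) (l : List (Fin K)) (hl : l.Nodup) :
    l.foldl (fun x j => flow (C j).curve ((Pi.single k s : Fin K → ℝ) j) x) x =
      if k ∈ l then flow (C k).curve s x else x := by
  induction l generalizing x with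
  | nil => simp
  | cons j l ih =>
    rw [List.nodup_cons] at hl
    rw [List.foldl_cons, ih _ hl.2]
    by_cases hj : k = j
    · subst hj
      simp [hl.1]
    · simp [hj, flow_zero]

/-! ### Differentiability -/

/-- The real part of a quaternion as a continuous linear map. -/
noncomputable def reCLM : Quaternion ℝ →L[ℝ] ℝ :=
  ⟨QuaternionAlgebra.reₗ _ _ _, Quaternion.continuous_re⟩

/-- The imaginary part of a quaternion as a continuous linear map. -/
noncomputable def imCLM : Quaternion ℝ →L[ℝ] Quaternion ℝ :=
  ⟨⟨⟨fun q => q.im, fun p q => by ext <;> simp⟩, fun c q => by ext <;> simp⟩,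
    Quaternion.continuous_im⟩

section

variable {V : Type} [NormedAddCommGroup V] [NormedSpace ℝ V]

theorem differentiable_mul {u v : V → SU2} (hu : Differentiable ℝ fun s => (u s : Quaternion ℝ))
    (hv : Differentiable ℝ fun s => (v s : Quaternion ℝ)) :
    Differentiable ℝ fun s => ((u s * v s : SU2) : Quaternion ℝ) :=
  hu.mul hv

theorem differentiable_inv {u : V → SU2} (hu : Differentiable ℝ fun s => (u s : Quaternion ℝ)) :
    Differentiable ℝ fun s => (((u s)⁻¹ : SU2) : Quaternion ℝ) := by
  -- On unit quaternions inversion is conjugation, `q⁻¹ = 2 Re(q) - q`, hence the restriction of a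
  -- real-linear map.
  have e : (fun s => (((u s)⁻¹ : SU2) : Quaternion ℝ)) =
      fun s => (2 * reCLM (u s : Quaternion ℝ)) • (1 : Quaternion ℝ) - (u s : Quaternion ℝ) := by
    funext s
    change star (u s : Quaternion ℝ) =
      (2 * (u s : Quaternion ℝ).re) • (1 : Quaternion ℝ) - (u s : Quaternion ℝ)
    rw [← Quaternion.coe_mul_eq_smul, mul_one]
    ext <;> simp
    ring
  rw [e]
  exact (((reCLM.differentiable.comp hu).const_mul 2).smul_const 1).sub hu

theorem differentiable_lift {n : ℕ} {x : V → Gen n → SU2}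
    (hx : ∀ E, Differentiable ℝ fun s => (x s E : Quaternion ℝ)) (w : FreeGroup (Gen n)) :
    Differentiable ℝ fun s => (FreeGroup.lift (x s) w : Quaternion ℝ) := by
  induction w with
  | C1 => simp
  | of E => simpa using hx E
  | inv_of E h => simpa only [map_inv, FreeGroup.lift_apply_of] using differentiable_inv (hx E)
  | mul u v hu hv => simpa only [map_mul] using differentiable_mul hu hv

theorem differentiable_pertMap {f : V → ℝ} (hf : Differentiable ℝ f) {u : V → SU2}
    (hu : Differentiable ℝ fun s => (u s : Quaternion ℝ)) :
    Differentiable ℝ fun s => (pertMap (f s) (u s) : Quaternion ℝ) := by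
  have he : Differentiable ℝ (NormedSpace.exp : Quaternion ℝ → Quaternion ℝ) :=
    fun q => (NormedSpace.exp_analytic (𝕂 := ℝ) q).differentiableAt
  exact he.comp (hf.smul (imCLM.differentiable.comp hu))

theorem differentiable_flow {n : ℕ} (C : Curve n) {f : V → ℝ} (hf : Differentiable ℝ f)
    {x : V → Gen n → SU2} (hx : ∀ E, Differentiable ℝ fun s => (x s E : Quaternion ℝ))
    (E : Gen n) : Differentiable ℝ fun s => (flow C (f s) (x s) E : Quaternion ℝ) := by
  have hm := differentiable_pertMap hf (differentiable_lift hx C.longitude)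
  have hc := fun c => differentiable_mul (differentiable_mul (differentiable_lift hx c) hm)
    (differentiable_inv (differentiable_lift hx c))
  unfold flow pushVal
  split
  · exact hx E
  · rename_i ε c _
    rcases Int.units_eq_one_or ε with rfl | rfl
    · simpa using differentiable_mul (hc c) (hx E)
    · simpa [mul_assoc] using differentiable_mul (differentiable_inv (hc c)) (hx E)
  · rename_i ε c _
    rcases Int.units_eq_one_or ε with rfl | rfl
    · simpa [mul_assoc] using
        differentiable_mul (differentiable_mul (hc c) (hx E)) (differentiable_inv (hc c))
    · simpa [mul_assoc] using
        differentiable_mul (differentiable_mul (differentiable_inv (hc c)) (hx E)) (hc c)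

theorem differentiable_foldl_flow {n K : ℕ} (C : Fin K → SpecialCurve n) {f : V → Fin K → ℝ}
    (hf : Differentiable ℝ f) (l : List (Fin K)) {x : V → Gen n → SU2}
    (hx : ∀ E, Differentiable ℝ fun s => (x s E : Quaternion ℝ)) (E : Gen n) :
    Differentiable ℝ fun s =>
      (l.foldl (fun x k => flow (C k).curve (f s k) x) (x s) E : Quaternion ℝ) := by
  induction l generalizing x with
  | nil => exact hx E
  | cons k l ih =>
    simp only [List.foldl_cons]
    exact ih (differentiable_flow _ (differentiable_pi.mp hf k) hx)

end

/-! ### The derivative along a single curve -/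

/-- The derivative at `t = 0` of the real part of the value at `E` of the image of `x` under the
perturbation along `C`, if that value is purely imaginary for `t = 0`. -/
noncomputable def slope {n : ℕ} (C : Curve n) (x : Gen n → SU2) (E : Gen n) : ℝ :=
  match C.crossing E with
  | Crossing.miss => 0
  | Crossing.loop ε _ => (ε : ℤ) * realPart (FreeGroup.lift x (C.longitudeAt E) * x E)
  | Crossing.arc _ _ => 0

/-- The velocity of `pertMap` at 0 is only `Im q`. It may be replaced by q itself because the scalar
part contributes `Re(q) Re(y) = 0`. -/
theorem hasDerivAt_re_pertMap (c q y : SU2) (hy : realPart y = 0) :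
    HasDerivAt (fun s => realPart (c * pertMap s q * c⁻¹ * y))
      (realPart (c * q * c⁻¹ * y)) 0 := by
  have h : HasDerivAt (fun s : ℝ => (pertMap s q : Quaternion ℝ)) (q : Quaternion ℝ).im 0 := by
    simpa [pertMap, NormedSpace.exp_zero] using
      hasDerivAt_exp_smul_const (𝕂 := ℝ) (q : Quaternion ℝ).im 0
  have h2 := reCLM.hasFDerivAt.comp_hasDerivAt (0 : ℝ)
    (((h.const_mul (c : Quaternion ℝ)).mul_const ((c⁻¹ : SU2) : Quaternion ℝ)).mul_const
      (y : Quaternion ℝ))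
  refine HasDerivAt.congr_deriv h2 (Eq.symm ?_)
  have hcc : (c : Quaternion ℝ) * ((c⁻¹ : SU2) : Quaternion ℝ) = 1 :=
    Unitary.mul_star_self_of_mem c.2
  have e : (q : Quaternion ℝ) = ((q : Quaternion ℝ).re : Quaternion ℝ) + (q : Quaternion ℝ).im :=
    (Quaternion.re_add_im _).symm
  change ((c : Quaternion ℝ) * q * ((c⁻¹ : SU2) : Quaternion ℝ) * y).re =
    ((c : Quaternion ℝ) * (q : Quaternion ℝ).im * ((c⁻¹ : SU2) : Quaternion ℝ) * y).re
  have hy2 : (y : Quaternion ℝ).re = 0 := hy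
  conv_lhs => rw [e]
  rw [mul_add, add_mul, add_mul, ← (Quaternion.coe_commute _ (c : Quaternion ℝ)).eq,
    mul_assoc _ (c : Quaternion ℝ), hcc, mul_one, Quaternion.re_add, Quaternion.coe_mul_eq_smul, Quaternion.re_smul, hy2]
  simp

theorem hasDerivAt_flow {n : ℕ} (C : Curve n) (x : Gen n → SU2) (E : Gen n)
    (hE : realPart (x E) = 0) :
    HasDerivAt (fun s => realPart (flow C s x E)) (slope C x E) 0 := by
  unfold flow pushVal slope Curve.longitudeAt
  cases C.crossing E with
  | miss => exact hasDerivAt_const (0 : ℝ) (realPart (x E))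
  | loop ε c =>
    have h := hasDerivAt_re_pertMap (FreeGroup.lift x c) (FreeGroup.lift x C.longitude) _ hE
    rcases Int.units_eq_one_or ε with rfl | rfl
    · simpa using h
    -- A negative crossing inserts the inverse meridian, which is the flow at time `-s`; the chain
    -- rule supplies the sign.
    · have h2 := HasDerivAt.comp (0 : ℝ) (h₂ := fun s => realPart (FreeGroup.lift x c *
        pertMap s (FreeGroup.lift x C.longitude) * (FreeGroup.lift x c)⁻¹ * x E))
        (by rw [neg_zero]; exact h) (hasDerivAt_neg (0 : ℝ))
      simpa [Function.comp_def, pertMap_neg, mul_assoc] using h2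
  | arc ε c =>
    simp only [realPart_conj]
    exact hasDerivAt_const (0 : ℝ) (realPart (x E))

theorem exists_hasFDerivAt_traceMap {n K : ℕ} (C : Fin K → SpecialCurve n)
    (ρ : SurfaceGroup n →* SU2) (hT : ∀ i, realPart (ρ (elemA i)) = 0) :
    ∃ L : (Fin K → ℝ) →L[ℝ] (Fin n → ℝ),
      HasFDerivAt (fun t => traceMap (perturbAll C (CharVar.mk ρ) t)) L 0 ∧
      ∀ k i, L (Pi.single k 1) i =
        slope (C k).curve (fun E => ρ (PresentedGroup.of E)) (Gen.A i) := by
  -- Joint differentiability holds at every t. Once it is known, the partial derivatives along the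
  -- coordinate axes determine L.
  have hd : Differentiable ℝ fun t => traceMap (perturbAll C (CharVar.mk ρ) t) := by
    refine differentiable_pi.mpr fun i => ?_
    simp only [traceMap_perturbAll]
    exact reCLM.differentiable.comp (differentiable_foldl_flow C (f := fun t => t)
      differentiable_id _ (x := fun _ E => ρ (PresentedGroup.of E))
      (fun E => differentiable_const _) _)
  refine ⟨_, (hd 0).hasFDerivAt, fun k i => ?_⟩
  have hline : HasDerivAt (fun s : ℝ => (Pi.single k s : Fin K → ℝ)) (Pi.single k 1) 0 := by
    simpa using (ContinuousLinearMap.single ℝ (fun _ : Fin K => ℝ) k).hasDerivAt (x := 0)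
  have h0 : (0 : Fin K → ℝ) = Pi.single k 0 := by simp
  have h1 := (hasDerivAt_pi.mp ((h0 ▸ (hd 0).hasFDerivAt :
    HasFDerivAt _ _ (Pi.single k (0 : ℝ) : Fin K → ℝ)).comp_hasDerivAt (0 : ℝ) hline)) i
  have h2 := hasDerivAt_flow (C k).curve (fun E => ρ (PresentedGroup.of E)) (Gen.A i) (hT i)
  have e : (fun s : ℝ => traceMap (perturbAll C (CharVar.mk ρ) (Pi.single k s)) i) =
      fun s => realPart (flow (C k).curve s (fun E => ρ (PresentedGroup.of E)) (Gen.A i)) := by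
    funext s
    rw [traceMap_perturbAll, foldl_flow_single C k s _ _ (List.nodup_finRange K),
      if_pos (List.mem_finRange k)]
  simp only [Function.comp_def] at h1
  rw [e] at h1
  simpa using h1.unique h2

/-! ### Purely imaginary unit quaternions -/

theorem realPart_mul_comm (p q : SU2) : realPart (p * q) = realPart (q * p) := by
  simpa [mul_assoc] using realPart_conj q (p * q) |>.symm

theorem realPart_one : realPart 1 = 1 := rfl

theorem realPart_neg (q : SU2) : realPart (-q) = -realPart q := rfl

theorem inv_eq_neg_of_realPart {q : SU2} (h : realPart q = 0) : q⁻¹ = -q := by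
  apply Subtype.ext
  change star (q : Quaternion ℝ) = -(q : Quaternion ℝ)
  have h2 : (q : Quaternion ℝ).re = 0 := h
  ext <;> simp [h2]

theorem mul_self_of_realPart {q : SU2} (h : realPart q = 0) : q * q = -1 := by
  have := mul_inv_cancel q
  rw [inv_eq_neg_of_realPart h, mul_neg] at this
  rw [← this, neg_neg]

/-- The inverse of `p * q` is `-(p * q)` because its real part vanishes, and also `(-q) * (-p) = q *
p`. -/
theorem mul_eq_neg_mul_of_realPart {p q : SU2} (hp : realPart p = 0) (hq : realPart q = 0)
    (h : realPart (p * q) = 0) : p * q = -(q * p) := by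
  have h1 := inv_eq_neg_of_realPart h
  rw [mul_inv_rev, inv_eq_neg_of_realPart hp, inv_eq_neg_of_realPart hq, neg_mul_neg] at h1
  rw [h1, neg_neg]

/-- A purely imaginary quaternion orthogonal to `D` and `AD`, for orthonormal purely imaginary
`A` and `D`, is a multiple of `A`. -/
theorem commute_of_realPart {A D X : SU2} (hD : realPart D = 0)
    (hAD : realPart (A * D) = 0) (hX : realPart X = 0) (hXD : realPart (X * D) = 0)
    (hXAD : realPart (X * (A * D)) = 0) : X * A = A * X := by
  -- X anticommutes with D and with `A * D`, so it commutes with their product `A * D * D = -A`.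
  have h1 := mul_eq_neg_mul_of_realPart hX hD hXD
  have h2 := mul_eq_neg_mul_of_realPart hX hAD hXAD
  have h3 : X * (A * D * D) = A * D * D * X := by
    rw [← mul_assoc, h2, neg_mul, mul_assoc, h1, mul_neg, neg_neg, mul_assoc (A * D)]
  rw [mul_assoc A, mul_self_of_realPart hD] at h3
  simpa using h3

/-! ### Curves which change the trace of a single generator -/

section

variable {A D X : SU2}

/-- The signs in `A⁻¹ = -A` and `D⁻¹ = -D` cancel, so the commutator is the square of the imaginary
unit `A * D`. -/
theorem comm_eq_neg_one (hA : realPart A = 0) (hD : realPart D = 0)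
    (hAD : realPart (A * D) = 0) : comm A D = -1 := by
  rw [comm, inv_eq_neg_of_realPart hA, inv_eq_neg_of_realPart hD, mul_neg, mul_neg,
    neg_mul, neg_neg, mul_assoc _ A, mul_self_of_realPart hAD]

theorem mul_mul_self_of_realPart (hA : realPart A = 0) (hD : realPart D = 0)
    (hAD : realPart (A * D) = 0) : A * D * A = D := by
  rw [mul_eq_neg_mul_of_realPart hA hD hAD, neg_mul, mul_assoc, mul_self_of_realPart hA]
  simp

/-- This and `realPart_mul_mul_mul` turn the slopes of IV, VIII and of VI, XI into the components of
X along `A * D` and D, the two that `commute_of_realPart` requires to vanish. -/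
theorem realPart_inv_mul_mul (hD : realPart D = 0) :
    realPart (D⁻¹ * X * A) = -realPart (X * (A * D)) := by
  rw [inv_eq_neg_of_realPart hD, mul_assoc, realPart_mul_comm, mul_assoc X, mul_neg, mul_neg,
    realPart_neg]

theorem realPart_mul_mul_mul (hA : realPart A = 0) (hD : realPart D = 0)
    (hAD : realPart (A * D) = 0) : realPart (A * X * A * D) = realPart (X * D) := by
  rw [mul_assoc (A * X), mul_assoc A, realPart_mul_comm, mul_assoc,
    mul_mul_self_of_realPart hA hD hAD]

end

/-! ### Commutator products in cyclic order. -/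

theorem lift_innerProd {G : Type} [Group G] {n : ℕ} (x : Gen n → G) (i j : Fin n) :
    FreeGroup.lift x (innerProd i j) = ((between i j).map (genComm x)).prod :=
  lift_comm_prod x _

theorem lift_outerProd {G : Type} [Group G] {n : ℕ} (x : Gen n → G) (i j : Fin n) :
    FreeGroup.lift x (outerProd i j) =
      genComm x i * ((between i j).map (genComm x)).prod * genComm x j := by
  have e := fun k => lift_comm_prod x [k]
  simp only [List.map_cons, List.map_nil, List.prod_cons, List.prod_nil, mul_one] at e
  rw [outerProd, map_mul, map_mul, lift_innerProd, e, e]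

/-- The quantity compared is the position in cyclic order counted from just after i: indices up to i
are shifted by n, so i itself comes last. It is the measure for the induction in
`mem_centralizer_of_slope`. -/
theorem mem_between_lt {n : ℕ} {i j l : Fin n} (h : l ∈ between i j) :
    (if i < l then l.val else l.val + n) < if i < j then j.val else j.val + n := by
  have hl := l.isLt
  have hj := j.isLt
  unfold between at h
  split_ifs at h ⊢ <;>
    simp only [List.mem_append, List.mem_filter, List.mem_finRange, true_and,
      decide_eq_true_eq, Fin.lt_def] at * <;> omega

/-! ### Slopes of the six families that move only one trace. -/

section

variable {n : ℕ} (x : Gen n → SU2)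

theorem slope_I (i l : Fin n) : slope (oneData i .I) x (.A l) =
    if l = i then -realPart (x (.A i) * x (.D i)) else 0 := by
  by_cases h : l = i
  · subst h
    simp [slope, oneData, Curve.longitudeAt, crossOne, a, d]
  · simp [slope, oneData, crossOne, h]

theorem slope_III (i l : Fin n) (hA : realPart (x (.A i)) = 0) :
    slope (oneData i .III) x (.A l) = if l = i then realPart (x (.D i)) else 0 := by
  by_cases h : l = i
  · subst h
    have e : x (.A l) * x (.D l) * x (.A l) =
        x (.A l) * (x (.D l) * (-1)) * (x (.A l))⁻¹ := by
      rw [inv_eq_neg_of_realPart hA]; simp [mul_assoc]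
    have e2 : realPart (x (.A l) * (x (.D l) * x (.A l))) = -realPart (x (.D l)) := by
      rw [← mul_assoc, e, realPart_conj, mul_neg_one, realPart_neg]
    simp [slope, oneData, Curve.longitudeAt, crossOne, a, d, mul_assoc, e2]
  · simp [slope, oneData, crossOne, h]

variable {i j : Fin n}

/-- The curve is taken for the pair (j, i) because IV crosses the A-loop of its second index; the
same applies to VIII. -/
theorem slope_IV (hij : i ≠ j) (l : Fin n) : slope (twoData j i .IV) x (.A l) =
    if l = i then realPart ((x (.D i))⁻¹ * x (.A j) * x (.A i)) else 0 := by
  by_cases h : l = i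
  · subst h
    simp [slope, twoData, Curve.longitudeAt, crossTwo, a, d, hij]
  · simp only [slope, twoData, crossTwo, h, if_false]
    split_ifs <;> rfl

theorem slope_VI (l : Fin n) : slope (twoData i j .VI) x (.A l) =
    if l = i then -realPart (x (.A i) * x (.A j) * x (.A i) * x (.D i)) else 0 := by
  by_cases h : l = i
  · subst h
    simp [slope, twoData, Curve.longitudeAt, crossTwo, a, d, mul_assoc]
  · simp only [slope, twoData, crossTwo, h, if_false]
    split_ifs <;> rfl

theorem slope_VIII (hij : i ≠ j) (l : Fin n) : slope (twoData j i .VIII) x (.A l) =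
    if l = i then realPart ((x (.D i))⁻¹ * ((FreeGroup.lift x (outerProd j i))⁻¹ * x (.A j) *
      FreeGroup.lift x (innerProd j i)) * x (.A i)) else 0 := by
  by_cases h : l = i
  · subst h
    simp [slope, twoData, Curve.longitudeAt, crossTwo, a, d, hij, mul_assoc]
  · simp only [slope, twoData, crossTwo, h, if_false]
    split_ifs <;> rfl

theorem slope_XI (l : Fin n) : slope (twoData i j .XI) x (.A l) =
    if l = i then -realPart (x (.A i) * (FreeGroup.lift x (innerProd i j) * x (.A j) *
      (FreeGroup.lift x (outerProd i j))⁻¹) * x (.A i) * x (.D i)) else 0 := by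
  by_cases h : l = i
  · subst h
    simp [slope, twoData, Curve.longitudeAt, crossTwo, a, d, mul_assoc]
  · simp only [slope, twoData, crossTwo, h, if_false]
    split_ifs <;> rfl

end

/-- If no curve changes the trace of `A_i` only, then `A_j` and `B_j` commute with `A_i`
for all `j`. -/
theorem mem_centralizer_of_slope {n : ℕ} (x : Gen n → SU2)
    (hx : ((List.finRange n).map (genComm x)).prod = 1) (hA : ∀ j, realPart (x (.A j)) = 0)
    (i : Fin n) (hi : ∀ C : SpecialCurve n, (∀ l, l ≠ i → slope C.curve x (.A l) = 0) →
      slope C.curve x (.A i) = 0) (j : Fin n) :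
    x (.A j) ∈ Subgroup.centralizer {x (.A i)} ∧
      x (.D j) * x (.A j) * (x (.D j))⁻¹ ∈ Subgroup.centralizer {x (.A i)} := by
  have hAD : realPart (x (.A i) * x (.D i)) = 0 := by
    have := hi (.one .I i) fun l hl => (slope_I x i l).trans (if_neg hl)
    simpa using (slope_I x i i).symm.trans this
  have hD : realPart (x (.D i)) = 0 := by
    have := hi (.one .III i) fun l hl => (slope_III x i l (hA i)).trans (if_neg hl)
    simpa using (slope_III x i i (hA i)).symm.trans this
  have hcomm : genComm x i = -1 := comm_eq_neg_one (hA i) hD hAD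
  have hZ : ∀ y : SU2, realPart y = 0 → realPart (y * x (.D i)) = 0 →
      realPart (y * (x (.A i) * x (.D i))) = 0 → y ∈ Subgroup.centralizer {x (.A i)} :=
    fun y h0 h1 h2 => Subgroup.mem_centralizer_singleton_iff.mpr
      (commute_of_realPart hD hAD h0 h1 h2)
  -- VI(ij) kills the component of `A_j` along `D_i`, and IV(ji) the one along `A_i D_i`.
  have hAj : ∀ j, x (.A j) ∈ Subgroup.centralizer {x (.A i)} := by
    intro j
    by_cases hij : i = j
    · subst hij
      exact Subgroup.mem_centralizer_singleton_iff.mpr rfl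
    refine hZ _ (hA j) ?_ ?_
    · have := hi (.two .VI i j hij) fun l hl => (slope_VI x l).trans (if_neg hl)
      have := (slope_VI x i).symm.trans this
      simpa [realPart_mul_mul_mul (hA i) hD hAD] using this
    · have := hi (.two .IV j i (Ne.symm hij)) fun l hl => (slope_IV x hij l).trans (if_neg hl)
      have := (slope_IV x hij i).symm.trans this
      simpa [realPart_inv_mul_mul hD] using this
  -- Since `genComm x j` is `A_j B_j⁻¹`, the middle factor is `A_j B_j A_j⁻¹`. The element is, up to
  -- sign, the factor X appearing in the slopes of both XI(ij) and VIII(ji).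
  have hY : ∀ j, i ≠ j → ((between i j).map (genComm x)).prod * (x (.A j) * (genComm x j)⁻¹) *
      (((between i j).map (genComm x)).prod)⁻¹ ∈ Subgroup.centralizer {x (.A i)} := by
    intro j hij
    have hrel := (prod_split _ i j hij).mp hx
    have h1 := hi (.two .XI i j hij) fun l hl => (slope_XI x l).trans (if_neg hl)
    replace h1 := (slope_XI x i).symm.trans h1
    have h2 := hi (.two .VIII j i (Ne.symm hij)) fun l hl => (slope_VIII x hij l).trans (if_neg hl)
    replace h2 := (slope_VIII x hij i).symm.trans h2
    rw [if_pos rfl] at h1 h2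
    rw [realPart_mul_mul_mul (hA i) hD hAD, lift_innerProd, lift_outerProd] at h1
    rw [realPart_inv_mul_mul hD, lift_innerProd, lift_outerProd] at h2
    rw [hcomm] at h1 h2 hrel
    generalize ((between i j).map (genComm x)).prod = W at *
    generalize ((between j i).map (genComm x)).prod = V at *
    -- VIII(ji) involves the product V over the complementary arc from j to i. The surface relation,
    -- with `[A_i, D_i] = -1`, expresses V through W, so both curves test the same quaternion.
    have hV : V = -(W * genComm x j)⁻¹ := by
      rw [← mul_assoc, neg_one_mul, neg_mul, neg_mul] at hrel
      rw [← mul_neg] at hrel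
      rw [inv_eq_of_mul_eq_one_right hrel, neg_neg]
    -- This element is the conjugate of `A_j` by `A_j D_j`.
    have hB : realPart (x (.A j) * (genComm x j)⁻¹) = 0 := by
      have e : x (.A j) * (genComm x j)⁻¹ =
        (x (.A j) * x (.D j)) * x (.A j) * (x (.A j) * x (.D j))⁻¹ := by
        simp [genComm, comm, mul_assoc]
      rw [e, realPart_conj, hA]
    refine hZ _ ?_ ?_ ?_
    · rw [realPart_conj, hB]
    · simpa [mul_assoc, realPart_neg] using h1
    · subst hV
      simpa [mul_assoc, realPart_neg] using h2
  refine ⟨hAj j, ?_⟩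
  -- Induction on the cyclic position of j after i: W involves only indices strictly between i and
  -- j, for which the claim is already available.
  induction hm : (if i < j then j.val else j.val + n) using Nat.strong_induction_on
    generalizing j with
  | _ m ih =>
    subst hm
    by_cases hij : i = j
    · subst hij
      -- For j = i, anticommutation of `A_i` and `D_i` gives `B_i = A_i⁻¹`.
      have e : x (.D i) * x (.A i) = (x (.A i))⁻¹ * x (.D i) := by
        rw [inv_eq_neg_of_realPart (hA i), neg_mul,
          mul_eq_neg_mul_of_realPart (hA i) hD hAD, neg_neg]
      rw [e, mul_inv_cancel_right]
      exact inv_mem (hAj i)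
    have hc : ∀ k, x (.D k) * x (.A k) * (x (.D k))⁻¹ ∈ Subgroup.centralizer {x (.A i)} →
        genComm x k ∈ Subgroup.centralizer {x (.A i)} := fun k hk => by
      have := mul_mem (hAj k) (inv_mem hk)
      simpa [genComm, comm, mul_assoc] using this
    have hW : ((between i j).map (genComm x)).prod ∈ Subgroup.centralizer {x (.A i)} := by
      refine Subgroup.list_prod_mem _ fun g hg => ?_
      obtain ⟨l, hl, rfl⟩ := List.mem_map.mp hg
      exact hc l (ih _ (mem_between_lt hl) l rfl)
    -- W and `A_j` both lie in the centralizer, so conjugating back by W and then by `A_j` leaves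
    -- `B_j` in it.
    have h1 := mul_mem (mul_mem (inv_mem hW) (hY j hij)) hW
    have h2 := mul_mem (mul_mem (inv_mem (hAj j)) h1) (hAj j)
    simpa [genComm, comm, mul_assoc] using h2

end TangleSurface

/-! ### Surjectivity of the differential. -/

theorem proposition8p2 (n : ℕ)
    (C : Fin (TangleSurface.numCurves n) ≃ TangleSurface.SpecialCurve n)
    (ρ : TangleSurface.SurfaceGroup n →* TangleSurface.SU2)
    (hF : TangleSurface.IsIrreducible ρ)
    (hS : TangleSurface.IsIrreducible (ρ.comp (TangleSurface.inclusion n)))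
    (hT : ∀ i : Fin n, TangleSurface.realPart (ρ (TangleSurface.elemA i)) = 0) :
    ∃ L : (Fin (TangleSurface.numCurves n) → ℝ) →L[ℝ] (Fin n → ℝ),
      HasFDerivAt
        (fun t : Fin (TangleSurface.numCurves n) → ℝ =>
          TangleSurface.traceMap
            (TangleSurface.perturbAll C (TangleSurface.CharVar.mk ρ) t)) L 0 ∧
      Function.Surjective L := by
  obtain ⟨L, hL, hk⟩ := TangleSurface.exists_hasFDerivAt_traceMap C ρ hT
  refine ⟨L, hL, ?_⟩
  have hx : ((List.finRange n).map
      (TangleSurface.genComm fun E => ρ (PresentedGroup.of E))).prod = 1 := by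
    rw [← TangleSurface.lift_surfaceRelator, ← TangleSurface.map_mk_eq_lift,
      PresentedGroup.one_of_mem (Set.mem_singleton _), map_one]
  have hsingle : ∀ i, (Pi.single i 1 : Fin n → ℝ) ∈ LinearMap.range L.toLinearMap := by
    intro i
    by_contra hi
    have hz := TangleSurface.mem_centralizer_of_slope _ hx hT i fun D hD => by
      by_contra hne
      -- A curve D with nonzero slope at `A_i` and zero slope at every other `A_l` would, after
      -- rescaling its coordinate vector, map exactly to the i-th basis vector.
      refine hi ⟨(TangleSurface.slope D.curve (fun E => ρ (PresentedGroup.of E)) (.A i))⁻¹ •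
        Pi.single (C.symm D) 1, ?_⟩
      funext l
      rw [map_smul, Pi.smul_apply, ContinuousLinearMap.coe_coe, hk, C.apply_symm_apply]
      by_cases hl : l = i
      · subst hl
        simp [hne]
      · simp [hl, hD l hl]
    have hcent : ∀ y, ρ (TangleSurface.inclusion n y) ∈
        Subgroup.centralizer {ρ (TangleSurface.elemA i)} := by
      intro y
      have hle : Subgroup.closure (Set.range PresentedGroup.of) ≤
          (Subgroup.centralizer {ρ (TangleSurface.elemA i)}).comap
            (ρ.comp (TangleSurface.inclusion n)) := by
        rw [Subgroup.closure_le]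
        rintro _ ⟨E, rfl⟩
        cases E with
        | A j => simpa [TangleSurface.inclusion, TangleSurface.elemA, TangleSurface.elemD] using (hz j).1
        | B j => simpa [TangleSurface.inclusion, TangleSurface.elemA, TangleSurface.elemD] using (hz j).2
      rw [PresentedGroup.closure_range_of] at hle
      exact hle (Subgroup.mem_top y)
    -- `ρ(A_i)` stabilizes the restriction to `π₁(S₀)`, so it is `±1`, whose real part `±1` is not
    -- zero.
    have hpm := (hS (ρ (TangleSurface.elemA i))).mp fun y => by
      rw [mul_inv_eq_iff_eq_mul]
      exact (Subgroup.mem_centralizer_singleton_iff.mp (hcent y)).symm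
    have h0 := hT i
    rcases hpm with h | h <;> rw [h] at h0 <;>
      norm_num [TangleSurface.realPart_neg, TangleSurface.realPart_one] at h0
  rw [← ContinuousLinearMap.coe_coe, ← LinearMap.range_eq_top, eq_top_iff]
  intro v _
  rw [← Finset.univ_sum_single v]
  refine Submodule.sum_mem _ fun i _ => ?_
  have : (Pi.single i (v i) : Fin n → ℝ) = v i • Pi.single i 1 := by
    rw [← Pi.single_smul, smul_eq_mul, mul_one]
  rw [this]
  exact Submodule.smul_mem _ _ (hsingle i)
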